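/- Let $k,m\ge 0$ be integers, let $q=2m$ or $q=2m+1$, let $r\ge 1$ be an integer and $\delta>0$. Write $\mathbb D^q\supset\mathbb B^q$ for the closed and the open unit disk in $\mathbb R^q$, and let $\vec e_1,\dots,\vec e_k$ be the standard basis of $\mathbb Z^k$. Identify $\mathbb R^q$ with $\mathbb C^m$ or $\mathbb C^m\times\mathbb R$, and for $\vec a\in\mathbb R^m$ let $\overline{\exp}(\vec a)=(e^{2\pi i a_1},\dots,e^{2\pi i a_m})$ act on $\mathbb R^q$ by coordinatewise multiplication on $\mathbb C^m$ (and trivially on the factor $\mathbb R$, if present). If a sequence $(\alpha_\ell)_{\ell\ge 0}$ of non-zero homomorphisms $\alpha_\ell:\mathbb Z^k\to\mathbb Q^m$ tends to zero sufficiently rapidly, then there is an action with the properties below. Precisely: there are bounds $\eta_\ell(\alpha_0,\dots,\alpha_{\ell-1})>0$ ($\ell\ge 0$), depending only on $k,m,q,r,\delta$, on $\ell$ and on the preceding representations, such that for every sequence of non-zero homomorphisms $\alpha_\ell:\mathbb Z^k\to\mathbb Q^m$ with $\|\alpha_\ell(\vec e_j)\|<\eta_\ell(\alpha_0,\dots,\alpha_{\ell-1})$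 for all $\ell$ and $j$ there is a $C^r$ action $h:\mathbb Z^k\to\mathrm{Diff}^r(\mathbb D^q)$ such that each $h_j=h(\vec e_j)$ is $\delta$-close to the identity in the uniform $C^r$ topology and 1. $h_j$ fixes the origin; 2. $h_j$ is the identity on a neighborhood of the boundary $\mathbb S^{q-1}$; 3. $h_j$ preserves the standard volume form on $\mathbb D^q$; 4. $h_j$ has zero topological entropy; and moreover 5. there is an $h$-invariant Cantor set $\widehat K\subset\mathbb B^q$ on which the action is minimal (every orbit in $\widehat K$ is dense in $\widehat K$); 6. the action $h$ on $\mathbb D^q$ is distal: for $x\ne y$ one has $\inf_{\gamma\in\mathbb Z^k}\|h(\gamma)x-h(\gamma)y\|>0$; 7. there are homomorphisms $\varphi_\ell:\mathbb Z^k\to\mathbb Z^k$ with positive determinant and with image the kernel of $\alpha_\ell$ mod $\mathbb Z^m$, i.e. of $\mathbb Z^k\xrightarrow{\alpha_\ell}\mathbb Q^m\to\mathbb Q^m/\mathbb Z^m$, such that, with $\Phi_0=\mathrm{id}$, $\Phi_{\ell+1}=\Phi_\ell\circ\varphi_\ell$ and $\Gamma_\ell=\Phi_\ell(\mathbb Z^k)$,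 the following holds. There are radii $0<s_\ell<R_\ell$ and points $c_{\ell,\gamma}$ ($\gamma\in\mathbb Z^k$), where $c_{\ell,\gamma}$ depends only on the coset $\gamma+\Gamma_\ell$, such that for each $\ell$ the closed disks of radius $R_\ell$ about $c_{\ell,\gamma}$ lie in $\mathbb D^q$ and are disjoint for distinct cosets. Let $V_\ell$ and $U_\ell$ be the unions over $\gamma$ of the open disks of radius $R_\ell$, respectively $s_\ell$, about $c_{\ell,\gamma}$. Then: - the open sets $V_\ell$ are nested, $\overline{V_{\ell+1}}\subset V_\ell$, with $\bigcap_\ell V_\ell=\widehat K$, and $h(\gamma)$ maps the disk of $V_\ell$ about $c_{\ell,\gamma'}$ onto the one about $c_{\ell,\gamma+\gamma'}$; - the open sets $U_\ell\subset V_\ell$ are $h$-invariant and converge to $\widehat K$ in the Hausdorff distance; - the restriction of $h$ to $U_\ell$ is periodic (a subgroup of finite index acts trivially), and the subgroup acting trivially on $U_\ell$ is exactly $\Gamma_{\ell+1}$; - the restriction of $h$ to $U_\ell$ is induced from $\alpha_\ell$ mod $\mathbb Z^m$: there is a homomorphism $\beta_\ell:\mathbb Z^k\to\mathbb Q^m$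 with $\beta_\ell\circ\Phi_\ell\equiv\alpha_\ell$ mod $\mathbb Z^m$ and $$h(\gamma)(x)=c_{\ell,\gamma+\gamma'}+\overline{\exp}(\beta_\ell(\gamma))\cdot(x-c_{\ell,\gamma'})\qquad\text{whenever }\|x-c_{\ell,\gamma'}\|<s_\ell,\ \gamma,\gamma'\in\mathbb Z^k .$$ In particular $\Gamma_\ell\cong\mathbb Z^k$ preserves each disk of $U_\ell$ and acts on it through $\overline{\exp}\circ\alpha_\ell$. -/

import Mathlib

open Filter Topology

noncomputable section

/-- Euclidean space `ℝ^q`. -/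
abbrev Euc (q : ℕ) : Type := EuclideanSpace ℝ (Fin q)

/-- The closed unit disk `𝔻^q` of `ℝ^q`. -/
abbrev Disk (q : ℕ) : Type := Metric.closedBall (0 : Euc q) 1

/-- A self-map of the disk, read as a map `ℝ^q → ℝ^q`. Off the disk it is the identity, but
below only values and derivatives within the disk are used. -/
def diskMap {q : ℕ} (f : Disk q → Disk q) : Euc q → Euc q :=
  Function.extend Subtype.val (fun x => (f x : Euc q)) id

lemma diskMap_coe {q : ℕ} (f : Disk q → Disk q) (x : Disk q) :
    diskMap f (x : Euc q) = f x :=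
  Subtype.val_injective.extend_apply _ _ x

/-- The group `Diff^r(𝔻^q)` of bijections of the closed disk that are `C^r`, up to the boundary,
together with their inverse. -/
def DiffDisk (q r : ℕ) : Subgroup (Equiv.Perm (Disk q)) where
  carrier := {f | ContDiffOn ℝ r (diskMap f) (Metric.closedBall 0 1) ∧
    ContDiffOn ℝ r (diskMap f.symm) (Metric.closedBall 0 1)}
  one_mem' := by
    have h : ContDiffOn ℝ r (diskMap (id : Disk q → Disk q)) (Metric.closedBall 0 1) :=
      contDiffOn_id.congr fun x hx => diskMap_coe id ⟨x, hx⟩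
    exact ⟨h, h⟩
  mul_mem' := by
    have key : ∀ f g : Disk q → Disk q,
        ContDiffOn ℝ r (diskMap f) (Metric.closedBall 0 1) →
        ContDiffOn ℝ r (diskMap g) (Metric.closedBall 0 1) →
        ContDiffOn ℝ r (diskMap (f ∘ g)) (Metric.closedBall 0 1) := by
      intro f g hf hg
      refine (hf.comp hg fun x hx => ?_).congr fun x hx => ?_
      · have := diskMap_coe g ⟨x, hx⟩
        rw [this]
        exact (g ⟨x, hx⟩).2
      · have h1 := diskMap_coe g ⟨x, hx⟩
        have h2 := diskMap_coe (f ∘ g) ⟨x, hx⟩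
        have h3 := diskMap_coe f (g ⟨x, hx⟩)
        simp only [Function.comp_apply] at h1 h2 h3 ⊢
        rw [h2, h1, h3]
    rintro f g ⟨hf, hf'⟩ ⟨hg, hg'⟩
    exact ⟨key f g hf hg, key g.symm f.symm hg' hf'⟩
  inv_mem' := by
    rintro f ⟨hf, hf'⟩
    exact ⟨hf', hf⟩

/-- The transformation of the disk by which `γ ∈ ℤ^k` acts. -/
def act {k q r : ℕ} (h : Multiplicative (Fin k → ℤ) →* DiffDisk q r) (γ : Fin k → ℤ) :
    Disk q → Disk q :=
  (h (Multiplicative.ofAdd γ) : Equiv.Perm (Disk q))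

/-- The generator `e_j` of `ℤ^k`. -/
def gen {k : ℕ} (j : Fin k) : Fin k → ℤ := Pi.single j 1

/-- `f` is `δ`-close to the identity in the uniform `C^r` topology: all derivatives of `f - id`
of order `0, …, r` have norm less than `δ` at every point of the (compact) disk. -/
def CrCloseToId {q : ℕ} (r : ℕ) (δ : ℝ) (f : Disk q → Disk q) : Prop :=
  ∀ p ≤ r, ∀ x ∈ Metric.closedBall (0 : Euc q) 1,
    ‖iteratedFDerivWithin ℝ p (fun y => diskMap f y - y) (Metric.closedBall 0 1) x‖ < δ

/-- The standard volume form `dx_1 ∧ ⋯ ∧ dx_q` of `ℝ^q`. -/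
def stdVolumeForm (q : ℕ) : (Euc q) [⋀^Fin q]→ₗ[ℝ] ℝ :=
  (EuclideanSpace.basisFun (Fin q) ℝ).toBasis.det

/-- The pull-back of the standard volume form under `f` is the standard volume form, at every
point of the disk. -/
def PreservesVolumeForm {q : ℕ} (f : Disk q → Disk q) : Prop :=
  ∀ x ∈ Metric.closedBall (0 : Euc q) 1,
    (stdVolumeForm q).compLinearMap
      (fderivWithin ℝ (diskMap f) (Metric.closedBall 0 1) x : Euc q →ₗ[ℝ] Euc q) =
      stdVolumeForm q

/-- `f` is the identity on a neighborhood of the boundary sphere. -/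
def IsIdNearBoundary {q : ℕ} (f : Disk q → Disk q) : Prop :=
  ∃ W : Set (Disk q), IsOpen W ∧ {x : Disk q | ‖(x : Euc q)‖ = 1} ⊆ W ∧ ∀ x ∈ W, f x = x

/-- Nonempty, compact, totally disconnected and without isolated points; in a metric space
these are precisely the sets homeomorphic to the standard Cantor set. -/
def IsCantorSet {X : Type*} [TopologicalSpace X] (K : Set X) : Prop :=
  K.Nonempty ∧ IsCompact K ∧ IsTotallyDisconnected K ∧ Preperfect K

section Action

variable {G X : Type*}

/-- `S` is invariant under all the transformations `T g`. -/
def IsInvariantSet (T : G → X → X) (S : Set X) : Prop := ∀ g, T g '' S = S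

/-- Every orbit of a point of `S` is dense in `S`. -/
def IsMinimalOn [TopologicalSpace X] (T : G → X → X) (S : Set X) : Prop :=
  ∀ x ∈ S, S ⊆ closure (Set.range fun g => T g x)

/-- The orbits of distinct points stay a bounded distance apart. -/
def IsDistal [PseudoMetricSpace X] (T : G → X → X) : Prop :=
  ∀ x y, x ≠ y → ∃ c > 0, ∀ g, c ≤ dist (T g x) (T g y)

/-- A subgroup of finite index acts trivially on `S`. -/
def IsPeriodicOn [AddGroup G] (T : G → X → X) (S : Set X) : Prop :=
  ∃ H : AddSubgroup G, H.FiniteIndex ∧ ∀ g ∈ H, ∀ x ∈ S, T g x = x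

end Action

/-- The subgroup `ℤ^m` of `ℚ^m`. -/
def intLattice (m : ℕ) : AddSubgroup (Fin m → ℚ) :=
  ((Int.castAddHom ℚ).compLeft (Fin m)).range

/-- The representation `ℤ^k → ℚ^m → ℚ^m / ℤ^m` defined by `α`. -/
def finiteRep {k m : ℕ} (α : (Fin k → ℤ) →+ (Fin m → ℚ)) :
    (Fin k → ℤ) →+ (Fin m → ℚ) ⧸ intLattice m :=
  (QuotientAddGroup.mk' (intLattice m)).comp α

/-- The Euclidean norm of `v ∈ ℚ^m ⊆ ℝ^m`. -/
def ratNorm {m : ℕ} (v : Fin m → ℚ) : ℝ :=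
  ‖(WithLp.toLp 2 fun i => (v i : ℝ) : EuclideanSpace ℝ (Fin m))‖

/-- The element `(exp (2πi a_1), …, exp (2πi a_m))` of the torus `𝕋^m` acting on `ℝ^q`, where
`ℝ^q` is `ℂ^m` (if `q = 2m`) or `ℂ^m × ℝ` (if `q = 2m + 1`) through `z_j = x_{2j-1} + i x_{2j}`.
With indices from `0`, as here, `z_j = x_{2j} + i x_{2j+1}`. -/
def torusRot {m q : ℕ} (hq : q = 2 * m ∨ q = 2 * m + 1) (a : Fin m → ℝ) (x : Euc q) : Euc q :=
  WithLp.toLp 2 fun i : Fin q =>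
    if hi : (i : ℕ) < 2 * m then
      let j : Fin m := ⟨(i : ℕ) / 2, by omega⟩
      let z : ℂ := ⟨x ⟨2 * ((i : ℕ) / 2), by omega⟩, x ⟨2 * ((i : ℕ) / 2) + 1, by omega⟩⟩
      let w : ℂ := Complex.exp (2 * Real.pi * Complex.I * (a j : ℂ)) * z
      if (i : ℕ) % 2 = 0 then w.re else w.im
    else x i

/-- The compositions `Φ_0 = id`, `Φ_{ℓ+1} = φ_0 ∘ ⋯ ∘ φ_ℓ`. -/
def towerMap {k : ℕ} (φ : ℕ → (Fin k → ℤ) →+ (Fin k → ℤ)) : ℕ → (Fin k → ℤ) →+ (Fin k → ℤ)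
  | 0 => AddMonoidHom.id _
  | ℓ + 1 => (towerMap φ ℓ).comp (φ ℓ)

end

/-! The action is a limit of actions of `ℤ^k`, each obtained from the preceding one by twisting
inside finitely many disjoint disks. Suppose the current action moves the disks of stage `ℓ` as
rigid bodies: the disk about `c γ'` goes to the one about `c (γ + γ')` with rotation parameter `a
γ`, and `a` is integral on the sublattice `Γ_ℓ` that preserves each disk (`partialAct_of_mem`).
Extend `α_ℓ` from `Γ_ℓ ≅ ℤ^k` to a rational homomorphism `lift` on `ℤ^k`, and precede the rigid
motion by the twist that rotates each sphere about a center by a cutoff function of the radius times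
`lift γ`. Torus rotations commute and preserve these spheres, so the result is again an action
(`partialAct_add`), and twists preserve volume (`det_fderiv_twist`). On the concentric disks of half
the radius the cutoff is 1, so the new action is rigid there with parameter `a + lift`. A small disk
placed at distance `R / 4` from a center, in a direction with trivial stabilizer in the torus, has
an orbit whose disks are indexed by the cosets of `Γ_{ℓ+1}`; this orbit is the next stage. The cores
of radius `R / 8` are never modified again and form `U_ℓ`.

Radii shrink at least by the factor 8, so the displacements are uniformly summable and the limit is
a continuous action. For fixed stage data the derivatives of a twist displacement tend to zero with
its parameter, uniformly in space. As stage `ℓ` depends only on the earlier representations, a bound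
on `α_ℓ` in terms of these makes the displacements of the generators and their inverses summable in
`C^r` with total at most `δ / 2` (`Stage.exists_rate`, `SmallDisp`).

The dynamical properties come from the nested disks. Disks of a deep stage are small and are
permuted, and outside them the action is a finite stage, whose Lipschitz constants grow only
linearly along a cyclic group; hence zero entropy. For distality, consider the first stage at which
no disk contains both points: the points are then separated by disks or lie in a region where the
motion is rigid on each sphere. The intersection of the disk unions is minimal because every stage
is permuted transitively, and it is perfect because a small non-zero `α_ℓ` cannot be integral. -/

noncomputable section

/-! ### The torus action on Euclidean space -/

section Rotation

variable {m q : ℕ}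

/-- The involution of the coordinates of `ℝ^q` that exchanges real and imaginary parts. -/
def coordSwap (hq : q = 2 * m ∨ q = 2 * m + 1) (i : Fin q) : Fin q :=
  if hi : (i : ℕ) < 2 * m then
    if h : (i : ℕ) % 2 = 0 then ⟨i + 1, by omega⟩ else ⟨i - 1, by omega⟩
  else i

/-- The sign with which `coordSwap` enters multiplication by `i`. -/
def coordSign (m : ℕ) {q : ℕ} (i : Fin q) : ℝ :=
  if (i : ℕ) < 2 * m then if (i : ℕ) % 2 = 0 then -1 else 1 else 0

/-- The angle by which the torus element with parameter `a` rotates the `i`-th coordinate. -/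
def coordAngle (a : Fin m → ℝ) (i : Fin q) : ℝ :=
  if hi : (i : ℕ) < 2 * m then 2 * Real.pi * a ⟨(i : ℕ) / 2, by omega⟩ else 0

variable (hq : q = 2 * m ∨ q = 2 * m + 1)

lemma coordSwap_coordSwap (i : Fin q) : coordSwap hq (coordSwap hq i) = i := by
  apply Fin.ext
  unfold coordSwap
  by_cases hi : (i : ℕ) < 2 * m
  · by_cases h2 : (i : ℕ) % 2 = 0
    · have h3 : (i : ℕ) + 1 < 2 * m := by omega
      have h4 : ((i : ℕ) + 1) % 2 ≠ 0 := by omega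
      simp [hi, h2, h3, h4]
    · have h3 : (i : ℕ) - 1 < 2 * m := by omega
      have h4 : ((i : ℕ) - 1) % 2 = 0 := by omega
      simp only [hi, h2, ↓reduceDIte, h3, h4]
      omega
  · simp [hi]

lemma coordSign_coordSwap (i : Fin q) : coordSign m (coordSwap hq i) = -coordSign m i := by
  unfold coordSign coordSwap
  by_cases hi : (i : ℕ) < 2 * m
  · by_cases h2 : (i : ℕ) % 2 = 0
    · have h3 : (i : ℕ) + 1 < 2 * m := by omega
      have h4 : ((i : ℕ) + 1) % 2 ≠ 0 := by omega
      simp [hi, h2, h3, h4]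
    · have h3 : (i : ℕ) - 1 < 2 * m := by omega
      have h4 : ((i : ℕ) - 1) % 2 = 0 := by omega
      simp [hi, h2, h3, h4]
  · simp [hi]

lemma coordAngle_coordSwap (a : Fin m → ℝ) (i : Fin q) :
    coordAngle a (coordSwap hq i) = coordAngle a i := by
  unfold coordAngle coordSwap
  by_cases hi : (i : ℕ) < 2 * m
  · by_cases h2 : (i : ℕ) % 2 = 0
    · have h3 : (i : ℕ) + 1 < 2 * m := by omega
      have h4 : ((i : ℕ) + 1) / 2 = i / 2 := by omega
      simp [hi, h2, h3, h4]
    · have h3 : (i : ℕ) - 1 < 2 * m := by omega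
      have h4 : ((i : ℕ) - 1) / 2 = i / 2 := by omega
      simp [hi, h2, h3, h4]
  · simp [hi]

/-- The sign has square 1 except on the real factor, where it is 0 but the angle vanishes too. This
treats `q = 2m` and `q = 2m + 1` uniformly. -/
lemma coordSign_sq_mul (f : ℝ → ℝ) (hf : f 0 = 0) (a : Fin m → ℝ) (i : Fin q) :
    coordSign m i ^ 2 * f (coordAngle a i) = f (coordAngle a i) := by
  unfold coordSign coordAngle
  by_cases hi : (i : ℕ) < 2 * m
  · by_cases h2 : (i : ℕ) % 2 = 0 <;> simp [hi, h2]
  · simp [hi, hf]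

@[simp] lemma coordAngle_zero (i : Fin q) : coordAngle (0 : Fin m → ℝ) i = 0 := by
  simp [coordAngle]

lemma coordAngle_add (a b : Fin m → ℝ) (i : Fin q) :
    coordAngle (a + b) i = coordAngle a i + coordAngle b i := by
  unfold coordAngle
  by_cases hi : (i : ℕ) < 2 * m <;> simp [hi, mul_add]

lemma abs_coordAngle_le (a : Fin m → ℝ) (i : Fin q) : |coordAngle a i| ≤ 2 * Real.pi * ‖a‖ := by
  unfold coordAngle
  have hp := Real.pi_pos
  split_ifs with hi
  · rw [abs_mul, abs_of_pos (by positivity)]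
    gcongr
    exact norm_le_pi_norm a _
  · simp; positivity

lemma contDiff_coordAngle {n : WithTop ℕ∞} (i : Fin q) :
    ContDiff ℝ n fun a : Fin m → ℝ => coordAngle a i := by
  unfold coordAngle
  by_cases hi : (i : ℕ) < 2 * m
  · simp only [hi, ↓reduceDIte]; fun_prop
  · simp only [hi, ↓reduceDIte]; fun_prop

/-- One formula for all coordinates, real parts, imaginary parts and the real factor alike, so that
torus rotations can be handled without complex numbers or case distinctions. -/
lemma torusRot_apply (a : Fin m → ℝ) (x : Euc q) (i : Fin q) :
    torusRot hq a x i = Real.cos (coordAngle a i) * x i +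
      coordSign m i * Real.sin (coordAngle a i) * x (coordSwap hq i) := by
  unfold torusRot coordAngle coordSign coordSwap
  by_cases hi : (i : ℕ) < 2 * m
  · have e : ∀ t : ℝ, Complex.exp (2 * Real.pi * Complex.I * (t : ℂ)) =
        ⟨Real.cos (2 * Real.pi * t), Real.sin (2 * Real.pi * t)⟩ := by
      intro t
      have : (2 * Real.pi * Complex.I * (t : ℂ)) = ((2 * Real.pi * t : ℝ) : ℂ) * Complex.I := by
        push_cast; ring
      rw [this]
      apply Complex.ext
      · rw [Complex.exp_ofReal_mul_I_re]
      · rw [Complex.exp_ofReal_mul_I_im]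
    by_cases h2 : (i : ℕ) % 2 = 0
    · have h3 : 2 * ((i : ℕ) / 2) = i := by omega
      simp only [hi, h2, ↓reduceDIte, ↓reduceIte, h3, e, Complex.mul_re]
      ring
    · have h3 : 2 * ((i : ℕ) / 2) = i - 1 := by omega
      have h4 : (i : ℕ) - 1 + 1 = i := by omega
      simp only [hi, h2, ↓reduceDIte, ↓reduceIte, h3, h4, e, Complex.mul_im]
      ring
  · simp [hi]

lemma sum_coordSwap (f : Fin q → ℝ) : ∑ i, f (coordSwap hq i) = ∑ i, f i :=
  Equiv.sum_comp (Function.Involutive.toPerm _ (coordSwap_coordSwap hq)) f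

lemma norm_torusRot (a : Fin m → ℝ) (x : Euc q) : ‖torusRot hq a x‖ = ‖x‖ := by
  rw [EuclideanSpace.norm_eq, EuclideanSpace.norm_eq]
  congr 1
  simp only [Real.norm_eq_abs, sq_abs, torusRot_apply]
  have h1 : ∀ i, (Real.cos (coordAngle a i) * x i +
      coordSign m i * Real.sin (coordAngle a i) * x (coordSwap hq i)) ^ 2 =
      Real.cos (coordAngle a i) ^ 2 * x i ^ 2 +
      Real.sin (coordAngle a i) ^ 2 * x (coordSwap hq i) ^ 2 +
      2 * (coordSign m i * Real.sin (coordAngle a i) * Real.cos (coordAngle a i) * x i *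
        x (coordSwap hq i)) := by
    intro i
    have := coordSign_sq_mul (fun t => Real.sin t ^ 2) (by simp) a i
    linear_combination (x (coordSwap hq i)) ^ 2 * this
  simp only [h1, Finset.sum_add_distrib, ← Finset.mul_sum]
  -- The cross terms are odd under `coordSwap`, so their sum equals its negative.
  have h2 : ∑ i, coordSign m i * Real.sin (coordAngle a i) * Real.cos (coordAngle a i) * x i *
        x (coordSwap hq i) = 0 := by
    have := sum_coordSwap hq fun i => coordSign m i * Real.sin (coordAngle a i) *
      Real.cos (coordAngle a i) * x i * x (coordSwap hq i)
    simp only [coordSign_coordSwap, coordAngle_coordSwap, coordSwap_coordSwap] at this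
    have h3 : ∀ i, -coordSign m i * Real.sin (coordAngle a i) * Real.cos (coordAngle a i) *
      x (coordSwap hq i) * x i = -(coordSign m i * Real.sin (coordAngle a i) *
      Real.cos (coordAngle a i) * x i * x (coordSwap hq i)) := fun i => by ring
    simp only [h3, Finset.sum_neg_distrib] at this
    linarith
  have h4 : ∑ i, Real.sin (coordAngle a i) ^ 2 * x (coordSwap hq i) ^ 2 =
      ∑ i, Real.sin (coordAngle a i) ^ 2 * x i ^ 2 := by
    rw [← sum_coordSwap hq]
    simp only [coordAngle_coordSwap, coordSwap_coordSwap]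
  rw [h2, h4, mul_zero, add_zero, ← Finset.sum_add_distrib]
  refine Finset.sum_congr rfl fun i _ => ?_
  linear_combination (x i) ^ 2 * Real.cos_sq_add_sin_sq (coordAngle a i)

/-- The action of a torus element as a linear isometry. -/
def torusIsom (a : Fin m → ℝ) : Euc q →ₗᵢ[ℝ] Euc q where
  toFun := torusRot hq a
  map_add' x y := by
    ext i; simp only [torusRot_apply, PiLp.add_apply]; ring
  map_smul' t x := by
    ext i; simp only [torusRot_apply, PiLp.smul_apply, smul_eq_mul, RingHom.id_apply]; ring
  norm_map' := norm_torusRot hq a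

@[simp] lemma torusIsom_apply (a : Fin m → ℝ) (x : Euc q) :
    torusIsom hq a x = torusRot hq a x := rfl

lemma torusRot_sub (a : Fin m → ℝ) (x y : Euc q) :
    torusRot hq a (x - y) = torusRot hq a x - torusRot hq a y := (torusIsom hq a).map_sub x y

lemma torusRot_add (a : Fin m → ℝ) (x y : Euc q) :
    torusRot hq a (x + y) = torusRot hq a x + torusRot hq a y := (torusIsom hq a).map_add x y

@[simp] lemma torusRot_apply_zero (a : Fin m → ℝ) : torusRot hq a 0 = 0 := (torusIsom hq a).map_zero

lemma torusRot_add_angle (a b : Fin m → ℝ) (x : Euc q) :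
    torusRot hq (a + b) x = torusRot hq a (torusRot hq b x) := by
  ext i
  simp only [torusRot_apply, coordAngle_coordSwap, coordSign_coordSwap, coordSwap_coordSwap,
    coordAngle_add, Real.cos_add, Real.sin_add]
  have := coordSign_sq_mul (fun t => Real.sin t) (by simp) a i
  linear_combination (x i) * Real.sin (coordAngle b i) * this

@[simp] lemma torusRot_zero_angle (x : Euc q) : torusRot hq 0 x = x := by
  ext i; simp [torusRot_apply]

lemma torusRot_int (n : Fin m → ℤ) (x : Euc q) :
    torusRot hq (fun j => (n j : ℝ)) x = x := by
  ext i
  rw [torusRot_apply]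
  have : ∃ l : ℤ, coordAngle (fun j => (n j : ℝ)) i = l * (2 * Real.pi) := by
    unfold coordAngle
    split_ifs with h
    · exact ⟨n ⟨i / 2, by omega⟩, by ring⟩
    · exact ⟨0, by simp⟩
  obtain ⟨l, hl⟩ := this
  rw [hl, Real.cos_int_mul_two_pi,
    show (l : ℝ) * (2 * Real.pi) = ((2 * l : ℤ) : ℝ) * Real.pi by push_cast; ring,
    Real.sin_int_mul_pi]
  simp

/-- A torus element that fixes a vector with equal non-zero entries is trivial. -/
lemma exists_int_of_torusRot_eq {a : Fin m → ℝ} {x : Euc q} {t : ℝ} (ht : t ≠ 0)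
    (hx : ∀ i, x i = t) (h : torusRot hq a x = x) (j : Fin m) : ∃ n : ℤ, a j = n := by
  have hj : 2 * (j : ℕ) < 2 * m := by omega
  have hj' : 2 * (j : ℕ) + 1 < 2 * m := by omega
  have h1 := congrArg (fun y : Euc q => y ⟨2 * j, by omega⟩) h
  have h2 := congrArg (fun y : Euc q => y ⟨2 * j + 1, by omega⟩) h
  have e1 : (2 * (j : ℕ)) / 2 = j := by omega
  have e2 : (2 * (j : ℕ) + 1) / 2 = j := by omega
  have e3 : (2 * (j : ℕ) + 1) % 2 ≠ 0 := by omega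
  simp only [torusRot_apply, hx, coordAngle, coordSign, hj, hj', e1, e2, e3,
    ↓reduceDIte, ↓reduceIte, Nat.mul_mod_right] at h1 h2
  have h3 : Real.cos (2 * Real.pi * a j) = 1 := by
    -- The sine terms of the two coordinate equations have opposite signs and cancel in the sum.
    have : 2 * t * (Real.cos (2 * Real.pi * a j) - 1) = 0 := by linear_combination h1 + h2
    have := (mul_eq_zero.1 this).resolve_left (by simpa using ht)
    linarith
  obtain ⟨n, hn⟩ := (Real.cos_eq_one_iff _).1 h3
  refine ⟨n, ?_⟩
  have hp := Real.pi_pos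
  have : (2 * Real.pi) * (a j - n) = 0 := by linear_combination -hn
  have := (mul_eq_zero.1 this).resolve_left (by positivity)
  linarith

lemma norm_le_sum_abs (x : Euc q) : ‖x‖ ≤ ∑ i, |x i| := by
  rw [EuclideanSpace.norm_eq]
  apply Real.sqrt_le_iff.2
  refine ⟨Finset.sum_nonneg fun i _ => abs_nonneg _, ?_⟩
  simpa using Finset.sum_sq_le_sq_sum_of_nonneg (s := Finset.univ) (f := fun i => |x i|)
    (fun i _ => abs_nonneg _)

lemma abs_apply_le_norm (x : Euc q) (i : Fin q) : |x i| ≤ ‖x‖ := PiLp.norm_apply_le x i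

lemma norm_torusRot_sub_self_le (a : Fin m → ℝ) (x : Euc q) :
    ‖torusRot hq a x - x‖ ≤ (q * (4 * Real.pi)) * ‖a‖ * ‖x‖ := by
  refine (norm_le_sum_abs _).trans ?_
  have : ∀ i ∈ Finset.univ, |(torusRot hq a x - x) i| ≤ (4 * Real.pi) * ‖a‖ * ‖x‖ := by
    intro i _
    have hp := Real.pi_pos
    have e : (torusRot hq a x - x) i = (Real.cos (coordAngle a i) - 1) * x i +
        coordSign m i * Real.sin (coordAngle a i) * x (coordSwap hq i) := by
      rw [PiLp.sub_apply, torusRot_apply]; ring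
    have h1 : |Real.cos (coordAngle a i) - 1| ≤ 2 * Real.pi * ‖a‖ := by
      have := Real.abs_cos_sub_cos_le (coordAngle a i) 0
      simp only [Real.cos_zero, sub_zero] at this
      exact this.trans (abs_coordAngle_le a i)
    have h2 : |Real.sin (coordAngle a i)| ≤ 2 * Real.pi * ‖a‖ :=
      Real.abs_sin_le_abs.trans (abs_coordAngle_le a i)
    have h3 : |coordSign m i| ≤ 1 := by
      unfold coordSign; split_ifs <;> simp
    rw [e]
    calc _ ≤ |Real.cos (coordAngle a i) - 1| * |x i| +
          |coordSign m i| * |Real.sin (coordAngle a i)| * |x (coordSwap hq i)| := by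
            refine (abs_add_le _ _).trans ?_
            simp only [abs_mul, le_refl]
      _ ≤ 2 * Real.pi * ‖a‖ * ‖x‖ + 1 * (2 * Real.pi * ‖a‖) * ‖x‖ := by
            gcongr <;> apply abs_apply_le_norm
      _ = _ := by ring
  refine (Finset.sum_le_sum this).trans ?_
  simp only [Finset.sum_const, Finset.card_univ, Fintype.card_fin, nsmul_eq_mul]
  apply le_of_eq; ring

lemma norm_torusRot_sub_torusRot_le (a b : Fin m → ℝ) (x : Euc q) :
    ‖torusRot hq a x - torusRot hq b x‖ ≤ (q * (4 * Real.pi)) * ‖a - b‖ * ‖x‖ := by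
  have : torusRot hq a x = torusRot hq b (torusRot hq (a - b) x) := by
    rw [← torusRot_add_angle, add_sub_cancel]
  rw [this, ← torusRot_sub, norm_torusRot]
  exact norm_torusRot_sub_self_le hq _ x

lemma contDiff_torusRot {n : WithTop ℕ∞} :
    ContDiff ℝ n fun p : (Fin m → ℝ) × Euc q => torusRot hq p.1 p.2 := by
  rw [contDiff_euclidean]
  intro i
  simp only [torusRot_apply]
  have h : ContDiff ℝ n fun p : (Fin m → ℝ) × Euc q => coordAngle p.1 i :=
    (contDiff_coordAngle i).comp contDiff_fst
  have hx : ∀ j, ContDiff ℝ n fun p : (Fin m → ℝ) × Euc q => p.2 j := fun j => by fun_prop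
  exact (h.cos.mul (hx i)).add ((contDiff_const.mul h.sin).mul (hx _))

/-- An isometry has determinant `±1`, and a torus element is the square of the one with half the
parameter, so the sign is positive. -/
lemma det_torusIsom (a : Fin m → ℝ) : LinearMap.det (torusIsom hq a).toLinearMap = 1 := by
  have h1 : |LinearMap.det (torusIsom hq a).toLinearMap| = 1 := by
    rw [← LinearMap.normDet_eq_abs_det, LinearIsometry.normDet_eq_one]
  have h2 : (torusIsom hq a).toLinearMap = (torusIsom hq ((1 / 2 : ℝ) • a)).toLinearMap ∘ₗ
      (torusIsom hq ((1 / 2 : ℝ) • a)).toLinearMap := by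
    ext x : 1
    simp only [LinearMap.comp_apply, LinearIsometry.coe_toLinearMap, torusIsom_apply,
      ← torusRot_add_angle, ← add_smul]
    norm_num
  rw [h2, LinearMap.det_comp, abs_mul_self] at h1
  rw [h2, LinearMap.det_comp, h1]

end Rotation

/-! ### Twist maps -/

section Twist

variable {m q : ℕ}

/-- A smooth radial cutoff function, `1` on the ball of radius `R / 2`, `0` off that of radius `R`. -/
def cutoff (R : ℝ) (y : Euc q) : ℝ := Real.smoothTransition (2 - 2 * (‖y‖ ^ 2 / R ^ 2))

lemma cutoff_congr {R : ℝ} {x y : Euc q} (h : ‖x‖ = ‖y‖) : cutoff R x = cutoff R y := by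
  simp [cutoff, h]

lemma cutoff_of_le {R : ℝ} (hR : 0 < R) {y : Euc q} (h : ‖y‖ ≤ R / 2) : cutoff R y = 1 := by
  apply Real.smoothTransition.one_of_one_le
  have : ‖y‖ ^ 2 / R ^ 2 ≤ 1 / 2 := by
    rw [div_le_iff₀ (by positivity)]
    have := norm_nonneg y
    nlinarith
  linarith

lemma cutoff_of_ge {R : ℝ} (hR : 0 < R) {y : Euc q} (h : R ≤ ‖y‖) : cutoff R y = 0 := by
  apply Real.smoothTransition.zero_of_nonpos
  have : 1 ≤ ‖y‖ ^ 2 / R ^ 2 := by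
    rw [le_div_iff₀ (by positivity)]
    nlinarith
  linarith

lemma abs_cutoff_le (R : ℝ) (y : Euc q) : |cutoff R y| ≤ 1 :=
  abs_le.2 ⟨by linarith [Real.smoothTransition.nonneg (2 - 2 * (‖y‖ ^ 2 / R ^ 2)), cutoff.eq_1 R y],
    Real.smoothTransition.le_one _⟩

lemma contDiff_cutoff (n : ℕ∞) (R : ℝ) : ContDiff ℝ n (cutoff R : Euc q → ℝ) :=
  Real.smoothTransition.contDiff.comp
    (contDiff_const.sub (contDiff_const.mul ((contDiff_norm_sq ℝ).div_const _)))

lemma exists_lipschitzWith_cutoff {R : ℝ} (hR : 0 < R) :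
    ∃ C, LipschitzWith C (cutoff R : Euc q → ℝ) := by
  refine ContDiff.lipschitzWith_of_hasCompactSupport (𝕂 := ℝ) (n := 1) ?_
    (contDiff_cutoff 1 R) one_ne_zero
  refine HasCompactSupport.intro (isCompact_closedBall 0 R) fun x hx => cutoff_of_ge hR ?_
  simp at hx
  exact hx.le

variable (hq : q = 2 * m ∨ q = 2 * m + 1)

/-- Rotation of the sphere of radius `‖y‖` by the torus element with parameter `cutoff R y • b`. -/
def twist (R : ℝ) (b : Fin m → ℝ) (y : Euc q) : Euc q := torusRot hq (cutoff R y • b) y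

/-- The displacement of `twist`. -/
def twistDiff (R : ℝ) (b : Fin m → ℝ) (y : Euc q) : Euc q := twist hq R b y - y

lemma norm_twist (R : ℝ) (b : Fin m → ℝ) (y : Euc q) : ‖twist hq R b y‖ = ‖y‖ :=
  norm_torusRot hq _ y

lemma twist_of_le {R : ℝ} (hR : 0 < R) (b : Fin m → ℝ) {y : Euc q} (h : ‖y‖ ≤ R / 2) :
    twist hq R b y = torusRot hq b y := by
  rw [twist, cutoff_of_le hR h, one_smul]

lemma twistDiff_of_ge {R : ℝ} (hR : 0 < R) (b : Fin m → ℝ) {y : Euc q} (h : R ≤ ‖y‖) :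
    twistDiff hq R b y = 0 := by
  rw [twistDiff, twist, cutoff_of_ge hR h, zero_smul, torusRot_zero_angle, sub_self]

/-- The cutoff depends only on the norm, which rotations and twists preserve; hence twist parameters
add. This is why a modified stage is still an action. -/
lemma twist_torusRot_twist (R : ℝ) (a b b' : Fin m → ℝ) (y : Euc q) :
    twist hq R b (torusRot hq a (twist hq R b' y)) = torusRot hq a (twist hq R (b + b') y) := by
  have h : cutoff R (torusRot hq a (twist hq R b' y)) = cutoff R y :=
    cutoff_congr (by rw [norm_torusRot, norm_twist])
  rw [twist, h, twist, twist, ← torusRot_add_angle, ← torusRot_add_angle, ← torusRot_add_angle]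
  congr 1
  rw [smul_add]; abel

lemma norm_twistDiff_le (R : ℝ) (b : Fin m → ℝ) (y : Euc q) : ‖twistDiff hq R b y‖ ≤ 2 * ‖y‖ := by
  refine (norm_sub_le _ _).trans ?_
  rw [norm_twist]; linarith

/-- Joint smoothness in parameter and point makes the space derivatives depend continuously on the
parameter. -/
lemma contDiff_twistDiff_uncurry (n : ℕ∞) (R : ℝ) :
    ContDiff ℝ n fun p : (Fin m → ℝ) × Euc q => twistDiff hq R p.1 p.2 := by
  have h : ContDiff ℝ n fun p : (Fin m → ℝ) × Euc q => (cutoff R p.2 • p.1, p.2) :=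
    (((contDiff_cutoff n R).comp contDiff_snd).smul contDiff_fst).prodMk contDiff_snd
  exact ((contDiff_torusRot hq).comp h).sub contDiff_snd

lemma contDiff_twistDiff (n : ℕ∞) (R : ℝ) (b : Fin m → ℝ) : ContDiff ℝ n (twistDiff hq R b) :=
  ContDiff.comp (g := fun p : (Fin m → ℝ) × Euc q => twistDiff hq R p.1 p.2)
    (f := fun y => (b, y)) (contDiff_twistDiff_uncurry hq n R) (by fun_prop)

lemma iteratedFDeriv_twistDiff (R : ℝ) (p : ℕ) (b : Fin m → ℝ) (y : Euc q) :
    iteratedFDeriv ℝ p (twistDiff hq R b) y =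
      (iteratedFDeriv ℝ p (fun z : (Fin m → ℝ) × Euc q => twistDiff hq R z.1 z.2)
        (b, y)).compContinuousLinearMap fun _ => ContinuousLinearMap.inr ℝ (Fin m → ℝ) (Euc q) := by
  have h1 : twistDiff hq R b = (fun z : (Fin m → ℝ) × Euc q =>
      twistDiff hq R ((b, (0 : Euc q)) + z).1 ((b, (0 : Euc q)) + z).2) ∘
        ContinuousLinearMap.inr ℝ (Fin m → ℝ) (Euc q) := by
    ext y; simp
  have h2 := contDiff_twistDiff_uncurry hq p R
  have h3 : ContDiff ℝ p (fun z : (Fin m → ℝ) × Euc q =>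
      twistDiff hq R ((b, (0 : Euc q)) + z).1 ((b, (0 : Euc q)) + z).2) :=
    h2.comp (contDiff_const.add contDiff_id)
  rw [h1, ContinuousLinearMap.iteratedFDeriv_comp_right _ h3 _ le_rfl,
    iteratedFDeriv_comp_add_left (f := fun z : (Fin m → ℝ) × Euc q => twistDiff hq R z.1 z.2)]
  simp

/-- At parameter 0 the displacement vanishes. Continuity and the tube lemma give uniform smallness
over the compact ball of radius `R`, and outside it the displacement is locally zero. -/
lemma eventually_norm_iteratedFDeriv_twistDiff_le {R : ℝ} (hR : 0 < R) (p : ℕ) {ε : ℝ}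
    (hε : 0 < ε) :
    ∀ᶠ b in 𝓝 (0 : Fin m → ℝ), ∀ y, ‖iteratedFDeriv ℝ p (twistDiff hq R b) y‖ ≤ ε := by
  have hcont : Continuous fun z : (Fin m → ℝ) × Euc q =>
      iteratedFDeriv ℝ p (twistDiff hq R z.1) z.2 := by
    simp_rw [iteratedFDeriv_twistDiff]
    exact (ContinuousMultilinearMap.compContinuousLinearMapL (𝕜 := ℝ) (F := Euc q)
      fun _ : Fin p => ContinuousLinearMap.inr ℝ (Fin m → ℝ) (Euc q)).continuous.comp
      ((contDiff_twistDiff_uncurry hq p R).continuous_iteratedFDeriv le_rfl)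
  have hopen : IsOpen {z : (Fin m → ℝ) × Euc q |
      ‖iteratedFDeriv ℝ p (twistDiff hq R z.1) z.2‖ < ε} := isOpen_lt hcont.norm continuous_const
  have h0 : twistDiff hq R (0 : Fin m → ℝ) = fun _ => 0 := by
    ext y; simp [twistDiff, twist]
  obtain ⟨u, v, hu, -, h0u, hv, huv⟩ := generalized_tube_lemma
    (isCompact_singleton (x := (0 : Fin m → ℝ))) (isCompact_closedBall (0 : Euc q) R) hopen (by
      rintro ⟨b, y⟩ ⟨hb, -⟩
      obtain rfl : b = 0 := hb
      simp only [Set.mem_ofPred_eq, h0]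
      rw [iteratedFDeriv_fun_zero]
      simpa using hε)
  filter_upwards [hu.mem_nhds (h0u rfl)] with b hb y
  by_cases hy : ‖y‖ ≤ R
  · exact (huv (Set.mk_mem_prod hb (hv (by simpa using hy)))).le
  · have : twistDiff hq R b =ᶠ[𝓝 y] fun _ => 0 := by
      filter_upwards [(isOpen_lt continuous_const continuous_norm).mem_nhds (not_le.1 hy)] with z hz
      exact twistDiff_of_ge hq hR b (le_of_lt hz)
    rw [this.iteratedFDeriv ℝ p |>.eq_of_nhds, iteratedFDeriv_fun_zero]
    simpa using hε.le

lemma exists_twistDiff_small {R : ℝ} (hR : 0 < R) (r : ℕ) {ε : ℝ} (hε : 0 < ε) :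
    ∃ ρ > 0, ∀ b : Fin m → ℝ, ‖b‖ < ρ →
      ∀ p ≤ r, ∀ y, ‖iteratedFDeriv ℝ p (twistDiff hq R b) y‖ ≤ ε := by
  have : ∀ᶠ b in 𝓝 (0 : Fin m → ℝ), ∀ p ∈ Finset.range (r + 1),
      ∀ y, ‖iteratedFDeriv ℝ p (twistDiff hq R b) y‖ ≤ ε :=
    (eventually_all_finset _).2 fun p _ => eventually_norm_iteratedFDeriv_twistDiff_le hq hR p hε
  obtain ⟨ρ, hρ, h⟩ := Metric.eventually_nhds_iff.1 this
  exact ⟨ρ, hρ, fun b hb p hp => h (by simpa using hb) p (by simp; omega)⟩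

/-- Linearity of the bound in `‖b‖` is the point: it yields linear growth of Lipschitz constants
under iteration, hence zero entropy. -/
lemma exists_twistDiff_lipschitz {R : ℝ} (hR : 0 < R) :
    ∃ C : ℝ, 0 ≤ C ∧ ∀ (b : Fin m → ℝ) (x y : Euc q),
      ‖twistDiff hq R b x - twistDiff hq R b y‖ ≤ C * ‖b‖ * ‖x - y‖ := by
  obtain ⟨L, hL⟩ := exists_lipschitzWith_cutoff (q := q) hR
  have hp := Real.pi_pos
  set A : ℝ := q * (4 * Real.pi) with hA
  have hA0 : 0 ≤ A := by positivity
  refine ⟨A + A * L * R, by positivity, fun b => ?_⟩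
  -- In the splitting below the cutoff difference is multiplied by `‖y‖`, so only `y` has to lie in
  -- the ball; if both points lie outside, both displacements vanish.
  have key : ∀ x y : Euc q, ‖y‖ ≤ R →
      ‖twistDiff hq R b x - twistDiff hq R b y‖ ≤ (A + A * L * R) * ‖b‖ * ‖x - y‖ := by
    intro x y hy
    have e : twistDiff hq R b x - twistDiff hq R b y =
        (torusRot hq (cutoff R x • b) (x - y) - (x - y)) +
        (torusRot hq (cutoff R x • b) y - torusRot hq (cutoff R y • b) y) := by
      rw [twistDiff, twistDiff, twist, twist, torusRot_sub]; abel
    have h1 := norm_torusRot_sub_self_le hq (cutoff R x • b) (x - y)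
    have h2 := norm_torusRot_sub_torusRot_le hq (cutoff R x • b) (cutoff R y • b) y
    have h3 : ‖cutoff R x • b‖ ≤ ‖b‖ := by
      rw [norm_smul]
      exact mul_le_of_le_one_left (norm_nonneg _) (abs_cutoff_le R x)
    have h4 : ‖cutoff R x • b - cutoff R y • b‖ ≤ L * ‖x - y‖ * ‖b‖ := by
      rw [← sub_smul, norm_smul]
      gcongr
      simpa [dist_eq_norm] using hL.dist_le_mul x y
    rw [e]
    calc _ ≤ A * ‖cutoff R x • b‖ * ‖x - y‖ + A * ‖cutoff R x • b - cutoff R y • b‖ * ‖y‖ :=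
          (norm_add_le _ _).trans (add_le_add h1 h2)
      _ ≤ A * ‖b‖ * ‖x - y‖ + A * (L * ‖x - y‖ * ‖b‖) * R := by gcongr
      _ = _ := by ring
  intro x y
  by_cases hy : ‖y‖ ≤ R
  · exact key x y hy
  by_cases hx : ‖x‖ ≤ R
  · rw [norm_sub_rev, norm_sub_rev x]
    exact key y x hx
  · rw [twistDiff_of_ge hq hR b (not_le.1 hy).le, twistDiff_of_ge hq hR b (not_le.1 hx).le,
      sub_self, norm_zero]
    positivity

/-- Twist maps are infinitesimally volume preserving. -/
lemma det_fderiv_twist (R : ℝ) (b : Fin m → ℝ) (y : Euc q) :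
    (fderiv ℝ (twist hq R b) y).det = 1 := by
  set F : ℝ × Euc q → Euc q := fun p => torusRot hq (p.1 • b) p.2 with hF
  have hFd : Differentiable ℝ F := by
    have h : ContDiff ℝ 1 fun p : ℝ × Euc q => (p.1 • b, p.2) := by fun_prop
    exact ((contDiff_torusRot hq (n := 1)).comp h).differentiable one_ne_zero
  have hg : DifferentiableAt ℝ (cutoff R : Euc q → ℝ) y :=
    (contDiff_cutoff 1 R).differentiable one_ne_zero y
  set g := cutoff R y with hgdef
  set u : Euc q := fderiv ℝ F (0, y) (1, 0) with hu
  have hcurve : ∀ t : ℝ, HasDerivAt (fun s => F (s, y)) (fderiv ℝ F (t, y) (1, 0)) t := fun t =>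
    (hFd (t, y)).hasFDerivAt.comp_hasDerivAt (f := fun s => (s, y)) t ((hasDerivAt_id t).prodMk (hasDerivAt_const t y))
  have h1 : fderiv ℝ F (g, y) (1, 0) = torusIsom hq (g • b) u := by
    -- The one-parameter group property moves the derivative at time `g` back to time 0.
    have e : (fun s => F (s, y)) = fun s => torusIsom hq (g • b) (F (s - g, y)) := by
      ext1 s
      simp only [hF, torusIsom_apply, ← torusRot_add_angle, ← add_smul]
      congr 2; ring
    have h := hcurve 0
    rw [← sub_self g] at h
    have h' := ((torusIsom hq (g • b)).toContinuousLinearMap.hasFDerivAt).comp_hasDerivAt g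
      (h.comp_sub_const g g)
    refine (hcurve g).unique ?_
    rw [e]
    simp only [sub_self] at h'
    exact h'
  have h2 : ∀ v, fderiv ℝ F (g, y) (0, v) = torusIsom hq (g • b) v := by
    intro v
    have h := (hFd (g, y)).hasFDerivAt.comp y ((hasFDerivAt_const g y).prodMk (hasFDerivAt_id y))
    have h' : HasFDerivAt (fun z => F (g, z)) (torusIsom hq (g • b)).toContinuousLinearMap y :=
      (torusIsom hq (g • b)).toContinuousLinearMap.hasFDerivAt
    have := congrArg (fun L => L v) (h.unique h')
    simpa using this
  -- The vector `u` is tangent at `y` to an orbit of rotations, along which the cutoff is constant.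
  have h3 : fderiv ℝ (cutoff R) y u = 0 := by
    have h := hcurve 0
    have e : F (0, y) = y := by simp [hF]
    have h' := HasFDerivAt.comp_hasDerivAt (l := (cutoff R : Euc q → ℝ)) (l' := fderiv ℝ (cutoff R) y)
      (f := fun s => F (s, y)) 0 (by rw [e]; exact hg.hasFDerivAt) h
    have e2 : (cutoff R : Euc q → ℝ) ∘ (fun s => F (s, y)) = fun _ => cutoff R y := by
      ext1 s
      exact cutoff_congr (norm_torusRot hq _ y)
    rw [e2] at h'
    exact h'.unique (hasDerivAt_const _ _)
  have h4 : HasFDerivAt (twist hq R b) ((fderiv ℝ F (g, y)).comp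
      ((fderiv ℝ (cutoff R) y).prod (ContinuousLinearMap.id ℝ _))) y :=
    (hFd (g, y)).hasFDerivAt.comp (f := fun z => (cutoff R z, z)) y
      (hg.hasFDerivAt.prodMk (hasFDerivAt_id y))
  -- The derivative is a rotation after `v ↦ v + dg(v) u`, where `g` is the cutoff; the determinant
  -- of the latter is `1 + dg(u) = 1`.
  have h5 : ((fderiv ℝ (twist hq R b) y : Euc q →L[ℝ] Euc q) : Euc q →ₗ[ℝ] Euc q) =
      (torusIsom hq (g • b)).toLinearMap ∘ₗ
        LinearMap.transvection (fderiv ℝ (cutoff R) y : Euc q →ₗ[ℝ] ℝ) u := by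
    rw [h4.fderiv]
    ext1 v
    have e : ((fderiv ℝ (cutoff R) y v, v) : ℝ × Euc q) =
        fderiv ℝ (cutoff R) y v • ((1, 0) : ℝ × Euc q) + (0, v) := by simp
    simp only [ContinuousLinearMap.coe_coe, ContinuousLinearMap.comp_apply,
      ContinuousLinearMap.prod_apply, ContinuousLinearMap.id_apply, LinearMap.comp_apply,
      LinearMap.transvection.apply, LinearIsometry.coe_toLinearMap]
    rw [e, map_add, map_smul, h1, h2, map_add, map_smul, add_comm]
  rw [ContinuousLinearMap.det, h5, LinearMap.det_comp, det_torusIsom, LinearMap.transvection.det]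
  simp [h3]

end Twist

/-! ### Lattices and finite representations -/

section Lattice

variable {k m : ℕ}

lemma eq_sum_gen (x : Fin k → ℤ) : x = ∑ j, x j • gen j := by
  ext i
  simp [gen, Finset.sum_apply, Pi.single_apply]

lemma map_eq_sum_gen {A : Type*} [AddCommGroup A] (f : (Fin k → ℤ) →+ A) (x : Fin k → ℤ) :
    f x = ∑ j, x j • f (gen j) := by
  conv_lhs => rw [eq_sum_gen x]
  simp only [map_sum, map_zsmul]

lemma mem_intLattice {v : Fin m → ℚ} : v ∈ intLattice m ↔ ∃ n : Fin m → ℤ, ∀ i, v i = n i := by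
  constructor
  · rintro ⟨n, rfl⟩
    exact ⟨n, fun i => rfl⟩
  · rintro ⟨n, hn⟩
    exact ⟨n, funext fun i => (hn i).symm⟩

lemma finiteRep_apply_eq_zero {α : (Fin k → ℤ) →+ (Fin m → ℚ)} {γ : Fin k → ℤ} :
    finiteRep α γ = 0 ↔ α γ ∈ intLattice m :=
  QuotientAddGroup.eq_zero_iff _

lemma exists_zsmul_mem_intLattice (v : Fin m → ℚ) : ∃ D : ℤ, D ≠ 0 ∧ D • v ∈ intLattice m := by
  refine ⟨∏ i, ((v i).den : ℤ), Finset.prod_ne_zero_iff.2 fun i _ => by simp,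
    mem_intLattice.2 ⟨fun i => (∏ j ∈ Finset.univ.erase i, ((v j).den : ℤ)) * (v i).num,
      fun i => ?_⟩⟩
  rw [← Finset.prod_erase_mul _ _ (Finset.mem_univ i)]
  have := Rat.den_mul_eq_num (v i)
  simp only [Pi.smul_apply, zsmul_eq_mul]
  push_cast
  rw [mul_assoc, this]

lemma exists_zsmul_mem_ker (α : (Fin k → ℤ) →+ (Fin m → ℚ)) :
    ∃ D : ℤ, D ≠ 0 ∧ ∀ γ, D • γ ∈ (finiteRep α).ker := by
  choose D hD0 hD using fun j => exists_zsmul_mem_intLattice (α (gen j))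
  refine ⟨∏ j, D j, Finset.prod_ne_zero_iff.2 fun i _ => hD0 i, fun γ => ?_⟩
  rw [AddMonoidHom.mem_ker, finiteRep_apply_eq_zero, map_zsmul, map_eq_sum_gen α, Finset.smul_sum]
  refine sum_mem fun j _ => ?_
  rw [smul_comm, ← Finset.prod_erase_mul _ _ (Finset.mem_univ j), mul_smul]
  exact zsmul_mem (zsmul_mem (hD j) _) _

/-- Multiplication by `D` embeds `ℤ^k` in `N`. -/
lemma finrank_eq_of_zsmul_mem {N : Submodule ℤ (Fin k → ℤ)} {D : ℤ} (hD : D ≠ 0)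
    (h : ∀ γ, D • γ ∈ N) : Module.finrank ℤ N = Module.finrank ℤ (Fin k → ℤ) :=
  le_antisymm (Submodule.finrank_le N) <|
    ((LinearMap.lsmul ℤ (Fin k → ℤ) D).codRestrict N h).finrank_le_finrank_of_injective
      ((LinearMap.lsmul_injective hD).codRestrict _)

lemma finiteIndex_of_zsmul_mem {N : AddSubgroup (Fin k → ℤ)} {D : ℤ} (hD : D ≠ 0)
    (h : ∀ γ, D • γ ∈ N) : N.FiniteIndex := by
  have : Finite ((Fin k → ℤ) ⧸ AddSubgroup.toIntSubmodule N) :=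
    Submodule.finiteQuotientOfFreeOfRankEq _ (finrank_eq_of_zsmul_mem hD h)
  have : Finite ((Fin k → ℤ) ⧸ N) := this
  exact AddSubgroup.finiteIndex_of_finite_quotient

lemma det_ne_zero_of_injective {f : (Fin k → ℤ) →ₗ[ℤ] (Fin k → ℤ)} (hf : Function.Injective f) :
    LinearMap.det f ≠ 0 := by
  rw [← LinearMap.det_toMatrix']
  intro h
  obtain ⟨v, hv, h0⟩ := Matrix.exists_mulVec_eq_zero_iff.2 h
  rw [LinearMap.toMatrix'_mulVec] at h0
  exact hv (hf (by rw [h0, map_zero]))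

/-- A sublattice of finite index has a positively oriented basis. -/
lemma exists_det_pos_range_eq {N : AddSubgroup (Fin k → ℤ)} {D : ℤ} (hD : D ≠ 0)
    (h : ∀ γ, D • γ ∈ N) : ∃ φ : (Fin k → ℤ) →+ (Fin k → ℤ),
      φ.range = N ∧ 0 < LinearMap.det φ.toIntLinearMap := by
  set N' := AddSubgroup.toIntSubmodule N
  have hr : Module.finrank ℤ N' = k := by
    rw [finrank_eq_of_zsmul_mem hD h]; simp
  set e := (Module.finBasisOfFinrankEq ℤ N' hr).equivFun
  set f : (Fin k → ℤ) →ₗ[ℤ] (Fin k → ℤ) := N'.subtype ∘ₗ e.symm.toLinearMap with hf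
  have hfr : LinearMap.range f = N' := by
    rw [hf, LinearMap.range_comp, LinearEquiv.range, Submodule.map_top, Submodule.range_subtype]
  have hfd : LinearMap.det f ≠ 0 := det_ne_zero_of_injective <| by
    rw [hf, LinearMap.coe_comp]
    exact Subtype.val_injective.comp e.symm.injective
  have key : ∀ g : (Fin k → ℤ) →ₗ[ℤ] (Fin k → ℤ), LinearMap.range g = N' → 0 < LinearMap.det g →
      ∃ φ : (Fin k → ℤ) →+ (Fin k → ℤ), φ.range = N ∧ 0 < LinearMap.det φ.toIntLinearMap := by
    intro g hg hd
    refine ⟨g.toAddMonoidHom, ?_, hd⟩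
    ext x
    have : x ∈ LinearMap.range g ↔ x ∈ N := by rw [hg]; rfl
    rw [← this]; rfl
  rcases hfd.lt_or_gt with hneg | hpos
  · rcases k with _ | k
    · rw [LinearMap.det_eq_one_of_subsingleton] at hneg
      norm_num at hneg
    -- Reversing the first basis vector changes the sign of the determinant; being an involution it
    -- leaves the range unchanged.
    · set M : Matrix (Fin (k + 1)) (Fin (k + 1)) ℤ :=
        Matrix.diagonal (Function.update 1 0 (-1)) with hM
      have hdM : LinearMap.det (Matrix.toLin' M) = -1 := by
        rw [LinearMap.det_toLin', hM, Matrix.det_diagonal,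
          Finset.prod_update_of_mem (Finset.mem_univ _)]
        simp
      have hMM : (Matrix.toLin' M) ∘ₗ (Matrix.toLin' M) = LinearMap.id := by
        rw [← Matrix.toLin'_mul, hM, Matrix.diagonal_mul_diagonal, ← Matrix.toLin'_one,
          ← Matrix.diagonal_one]
        congr 2
        ext1 i
        by_cases hi : i = 0
        · subst hi; simp
        · simp [hi]
      have hs : Function.Surjective (Matrix.toLin' M) := fun x =>
        ⟨Matrix.toLin' M x, LinearMap.congr_fun hMM x⟩
      refine key (f ∘ₗ Matrix.toLin' M) ?_ ?_
      · rw [LinearMap.range_comp, LinearMap.range_eq_top.2 hs, Submodule.map_top, hfr]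
      · rw [LinearMap.det_comp, hdM]; linarith
  · exact key f hfr hpos

/-- A positively oriented basis of the kernel of `α` mod `ℤ^m`. -/
def kerBasis (α : (Fin k → ℤ) →+ (Fin m → ℚ)) : (Fin k → ℤ) →+ (Fin k → ℤ) :=
  (exists_det_pos_range_eq (exists_zsmul_mem_ker α).choose_spec.1
    (exists_zsmul_mem_ker α).choose_spec.2).choose

lemma range_kerBasis (α : (Fin k → ℤ) →+ (Fin m → ℚ)) :
    (kerBasis α).range = (finiteRep α).ker :=
  (exists_det_pos_range_eq (exists_zsmul_mem_ker α).choose_spec.1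
    (exists_zsmul_mem_ker α).choose_spec.2).choose_spec.1

lemma det_kerBasis_pos (α : (Fin k → ℤ) →+ (Fin m → ℚ)) :
    0 < LinearMap.det (kerBasis α).toIntLinearMap :=
  (exists_det_pos_range_eq (exists_zsmul_mem_ker α).choose_spec.1
    (exists_zsmul_mem_ker α).choose_spec.2).choose_spec.2

/-- The adjugate matrix is an integral inverse up to the determinant. Finite index, injectivity and
rational extensions all follow from it. -/
lemma exists_adjugate (Φ : (Fin k → ℤ) →+ (Fin k → ℤ)) :
    ∃ Ψ : (Fin k → ℤ) →+ (Fin k → ℤ),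
      (∀ γ, Ψ (Φ γ) = LinearMap.det Φ.toIntLinearMap • γ) ∧
      ∀ γ, Φ (Ψ γ) = LinearMap.det Φ.toIntLinearMap • γ := by
  set M := LinearMap.toMatrix' Φ.toIntLinearMap with hM
  have hΦ : ∀ γ, Φ γ = M.mulVec γ := fun γ => by
    rw [hM, LinearMap.toMatrix'_mulVec]; rfl
  refine ⟨(Matrix.toLin' M.adjugate).toAddMonoidHom, fun γ => ?_, fun γ => ?_⟩
  · change Matrix.toLin' M.adjugate (Φ γ) = _
    rw [hΦ, Matrix.toLin'_apply, Matrix.mulVec_mulVec, Matrix.adjugate_mul, Matrix.smul_mulVec,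
      Matrix.one_mulVec, ← LinearMap.det_toMatrix']
  · change Φ (Matrix.toLin' M.adjugate γ) = _
    rw [hΦ, Matrix.toLin'_apply, Matrix.mulVec_mulVec, Matrix.mul_adjugate, Matrix.smul_mulVec,
      Matrix.one_mulVec, ← LinearMap.det_toMatrix']

lemma finiteIndex_range {Φ : (Fin k → ℤ) →+ (Fin k → ℤ)}
    (h : LinearMap.det Φ.toIntLinearMap ≠ 0) : Φ.range.FiniteIndex := by
  obtain ⟨Ψ, -, hΨ⟩ := exists_adjugate Φ
  exact finiteIndex_of_zsmul_mem h fun γ => ⟨Ψ γ, hΨ γ⟩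

lemma injective_of_det_ne_zero {Φ : (Fin k → ℤ) →+ (Fin k → ℤ)}
    (h : LinearMap.det Φ.toIntLinearMap ≠ 0) : Function.Injective Φ := by
  obtain ⟨Ψ, hΨ, -⟩ := exists_adjugate Φ
  intro x y hxy
  have := hΨ x
  rw [hxy, hΨ y] at this
  exact (smul_right_injective _ h this).symm

/-- Homomorphisms to `ℚ^m` extend along inclusions of finite index, with a bound. -/
lemma exists_ratLift {Φ : (Fin k → ℤ) →+ (Fin k → ℤ)}
    (h : LinearMap.det Φ.toIntLinearMap ≠ 0) (m : ℕ) :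
    ∃ (lift : ((Fin k → ℤ) →+ (Fin m → ℚ)) → ((Fin k → ℤ) →+ (Fin m → ℚ))) (C : ℝ),
      0 < C ∧ ∀ α, (∀ γ, lift α (Φ γ) = α γ) ∧
        ∀ ε : ℝ, (∀ j i, |((α (gen j) i : ℚ) : ℝ)| ≤ ε) →
          ∀ j i, |((lift α (gen j) i : ℚ) : ℝ)| ≤ C * ε := by
  obtain ⟨Ψ, hΨ, -⟩ := exists_adjugate Φ
  set d := LinearMap.det Φ.toIntLinearMap
  have hd : (d : ℚ) ≠ 0 := by exact_mod_cast h
  set c : Fin k → Fin k → ℝ := fun j l => |(d : ℝ)⁻¹ * (Ψ (gen j) l : ℝ)| with hc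
  -- The extension is `α ∘ Φ⁻¹` over `ℚ`. The sum of all entries bounds each row sum, and the
  -- summand 1 makes the constant positive.
  refine ⟨fun α => (d : ℚ)⁻¹ • α.comp Ψ, 1 + ∑ j, ∑ l, c j l, ?_, fun α => ⟨fun γ => ?_, ?_⟩⟩
  · have : 0 ≤ ∑ j, ∑ l, c j l := Finset.sum_nonneg fun j _ => Finset.sum_nonneg fun l _ =>
      abs_nonneg _
    linarith
  · rw [AddMonoidHom.smul_apply, AddMonoidHom.comp_apply, hΨ, map_zsmul]
    ext i
    simp only [Pi.smul_apply]
    simp only [zsmul_eq_mul, smul_eq_mul]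
    field_simp
  · intro ε hε j i
    have hε0 : 0 ≤ ε := (abs_nonneg _).trans (hε j i)
    have e : ((((d : ℚ)⁻¹ • α.comp Ψ) (gen j) i : ℚ) : ℝ) =
        ∑ l, ((d : ℝ)⁻¹ * (Ψ (gen j) l : ℝ)) * ((α (gen l) i : ℚ) : ℝ) := by
      rw [AddMonoidHom.smul_apply, AddMonoidHom.comp_apply, map_eq_sum_gen α]
      simp only [Pi.smul_apply, Finset.sum_apply]
      simp only [zsmul_eq_mul, smul_eq_mul]
      push_cast
      rw [Finset.mul_sum]
      simp only [mul_assoc]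
    rw [e]
    calc _ ≤ ∑ l, c j l * ε := by
          refine (Finset.abs_sum_le_sum_abs _ _).trans (Finset.sum_le_sum fun l _ => ?_)
          rw [abs_mul]
          exact mul_le_mul_of_nonneg_left (hε l i) (abs_nonneg _)
      _ = (∑ l, c j l) * ε := by rw [Finset.sum_mul]
      _ ≤ _ := by
          gcongr
          have := Finset.single_le_sum (f := fun j => ∑ l, c j l)
            (fun j _ => Finset.sum_nonneg fun l _ => abs_nonneg _) (Finset.mem_univ j)
          linarith

/-- The inclusion of `ℚ^m` in `ℝ^m`. -/
def realVec (v : Fin m → ℚ) : Fin m → ℝ := fun i => (v i : ℝ)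

lemma realVec_add (v w : Fin m → ℚ) : realVec (v + w) = realVec v + realVec w := by
  ext i; simp [realVec]

@[simp] lemma realVec_zero : realVec (0 : Fin m → ℚ) = 0 := by
  ext i; simp [realVec]

lemma realVec_neg (v : Fin m → ℚ) : realVec (-v) = -realVec v := by
  ext i; simp [realVec]

lemma realVec_nsmul (n : ℕ) (v : Fin m → ℚ) : realVec (n • v) = (n : ℝ) • realVec v := by
  ext i; simp [realVec]

lemma torusRot_realVec_of_mem {q : ℕ} (hq : q = 2 * m ∨ q = 2 * m + 1) {v : Fin m → ℚ}
    (hv : v ∈ intLattice m) (x : Euc q) : torusRot hq (realVec v) x = x := by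
  obtain ⟨n, hn⟩ := mem_intLattice.1 hv
  have : realVec v = fun j => (n j : ℝ) := by
    ext i; simp [realVec, hn]
  rw [this, torusRot_int]

lemma abs_apply_le_ratNorm (v : Fin m → ℚ) (i : Fin m) : |((v i : ℚ) : ℝ)| ≤ ratNorm v :=
  PiLp.norm_apply_le (WithLp.toLp 2 fun i => (v i : ℝ) : EuclideanSpace ℝ (Fin m)) i

end Lattice

/-! ### The tower of disks -/

/-- A vector of norm `1 / 4` with equal entries. -/
def dirVec (q : ℕ) : Euc q :=
  (1 / (4 * ‖(WithLp.toLp 2 fun _ => 1 : Euc q)‖)) • (WithLp.toLp 2 fun _ => 1 : Euc q)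

lemma norm_ones_pos {q : ℕ} (hq : 0 < q) : 0 < ‖(WithLp.toLp 2 fun _ => 1 : Euc q)‖ := by
  rw [norm_pos_iff]
  intro h
  have := congrArg (fun y : Euc q => y ⟨0, hq⟩) h
  simp at this

lemma norm_dirVec {q : ℕ} (hq : 0 < q) : ‖dirVec q‖ = 1 / 4 := by
  have := norm_ones_pos hq
  rw [dirVec, norm_smul, Real.norm_of_nonneg (by positivity)]
  field_simp

lemma norm_dirVec_le (q : ℕ) : ‖dirVec q‖ ≤ 1 / 4 := by
  rcases Nat.eq_zero_or_pos q with rfl | hq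
  · rw [Subsingleton.elim (dirVec 0) 0]; simp
  · exact (norm_dirVec hq).le

/-- No complex coordinate vanishes, so only integral parameters fix this vector. -/
lemma exists_dirVec_apply (q : ℕ) : ∃ t : ℝ, t ≠ 0 ∧ ∀ i, dirVec q i = t := by
  rcases Nat.eq_zero_or_pos q with rfl | hq
  · exact ⟨1, one_ne_zero, fun i => i.elim0⟩
  · have := norm_ones_pos hq
    exact ⟨1 / (4 * ‖(WithLp.toLp 2 fun _ => 1 : Euc q)‖), by positivity, fun i => by simp [dirVec]⟩

lemma finite_range_of_const_on_cosets {G X : Type*} [AddGroup G] {N : AddSubgroup G} [N.FiniteIndex]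
    {c : G → X} (h : ∀ g g', g - g' ∈ N → c g = c g') : (Set.range c).Finite := by
  have : Finite (G ⧸ N) := inferInstance
  -- The quotient is by the relation `-g + g' ∈ N`, while the hypothesis concerns `g - g'`; negation
  -- exchanges the two.
  have h' : ∀ g g', -g + g' ∈ N → c (-g) = c (-g') := fun g g' hg =>
    h _ _ (by simpa using hg)
  refine (Set.finite_range fun x : G ⧸ N => Quotient.liftOn' x (fun g => c (-g)) fun a b hab =>
    h' a b (QuotientAddGroup.leftRel_apply.1 hab)).subset ?_
  rintro _ ⟨g, rfl⟩
  exact ⟨QuotientAddGroup.mk (-g), by simp [Quotient.liftOn'_mk'', QuotientAddGroup.mk]⟩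

lemma Set.Finite.exists_pos_lt {S : Set ℝ} (hS : S.Finite) (h : ∀ x ∈ S, 0 < x) {B : ℝ}
    (hB : 0 < B) : ∃ ρ > 0, ρ ≤ B ∧ ∀ x ∈ S, 2 * ρ < x := by
  have h1 : ∀ᶠ ρ in 𝓝[>] (0 : ℝ), ∀ x ∈ S, 2 * ρ < x := by
    refine (Filter.eventually_all_finite hS).2 fun x hx => ?_
    have h := h x hx
    filter_upwards [Ioo_mem_nhdsGT (show (0 : ℝ) < x / 2 by linarith)] with ρ hρ
    linarith [hρ.2]
  obtain ⟨ρ, h, h0, h2⟩ := (h1.and (Ioc_mem_nhdsGT hB)).exists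
  exact ⟨ρ, h0, h2, h⟩

/-- The data at one level of the construction: the sublattice of `ℤ^k` that preserves each disk,
the rotation parameters and the centers and radius of the disks. -/
structure Stage (k m q : ℕ) where
  Φ : (Fin k → ℤ) →+ (Fin k → ℤ)
  a : (Fin k → ℤ) →+ (Fin m → ℚ)
  c : (Fin k → ℤ) → Euc q
  R : ℝ
  det_pos : 0 < LinearMap.det Φ.toIntLinearMap
  -- Elements that preserve a disk of this stage act on it trivially before the modification.
  a_mem : ∀ γ ∈ Φ.range, a γ ∈ intLattice m
  R_pos : 0 < R
  c_eq : ∀ γ γ', γ - γ' ∈ Φ.range → c γ = c γ'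
  c_sep : ∀ γ γ', γ - γ' ∉ Φ.range → 2 * R < dist (c γ) (c γ')
  -- The bound `1 / 2` leaves a collar of the unit sphere on which nothing ever moves.
  norm_add_le : ∀ γ, ‖c γ‖ + R ≤ 1 / 2

namespace Stage

variable {k m q : ℕ} (hq : q = 2 * m ∨ q = 2 * m + 1) (S : Stage k m q)
  (α : (Fin k → ℤ) →+ (Fin m → ℚ))

lemma finite_range_c : (Set.range S.c).Finite := by
  have := finiteIndex_range S.det_pos.ne'
  exact finite_range_of_const_on_cosets S.c_eq

/-- The set of centers of a stage. -/
def centers : Finset (Euc q) := S.finite_range_c.toFinset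

lemma mem_centers {p : Euc q} : p ∈ S.centers ↔ ∃ γ, S.c γ = p := by
  simp [centers]

/-- The rational extension to `ℤ^k` of a homomorphism given in terms of the basis `S.Φ`. -/
def lift : (Fin k → ℤ) →+ (Fin m → ℚ) := (exists_ratLift S.det_pos.ne' m).choose α

lemma lift_apply (γ : Fin k → ℤ) : S.lift α (S.Φ γ) = α γ :=
  ((exists_ratLift S.det_pos.ne' m).choose_spec.choose_spec.2 α).1 γ

lemma exists_lift_le : ∃ C > 0, ∀ (α : (Fin k → ℤ) →+ (Fin m → ℚ)) (ε : ℝ),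
    (∀ j i, |((α (gen j) i : ℚ) : ℝ)| ≤ ε) →
      ∀ j i, |((S.lift α (gen j) i : ℚ) : ℝ)| ≤ C * ε :=
  ⟨_, (exists_ratLift S.det_pos.ne' m).choose_spec.choose_spec.1, fun α =>
    ((exists_ratLift S.det_pos.ne' m).choose_spec.choose_spec.2 α).2⟩

/-- The rotation parameters after the modification prescribed by `α`. -/
def nextA : (Fin k → ℤ) →+ (Fin m → ℚ) := S.a + S.lift α

/-- The centers of the disks of the next stage. -/
def nextC (γ : Fin k → ℤ) : Euc q := S.c γ + torusRot hq (realVec (S.nextA α γ)) (S.R • dirVec q)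

/-- The basis of the sublattice of the next stage. -/
def nextΦ : (Fin k → ℤ) →+ (Fin k → ℤ) := S.Φ.comp (kerBasis α)

lemma det_nextΦ_pos : 0 < LinearMap.det (S.nextΦ α).toIntLinearMap := by
  have : (S.nextΦ α).toIntLinearMap = S.Φ.toIntLinearMap ∘ₗ (kerBasis α).toIntLinearMap := rfl
  rw [this, LinearMap.det_comp]
  exact mul_pos S.det_pos (det_kerBasis_pos α)

lemma range_nextΦ_le : (S.nextΦ α).range ≤ S.Φ.range := by
  rintro _ ⟨γ, rfl⟩
  exact ⟨kerBasis α γ, rfl⟩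

lemma Φ_mem_range_nextΦ_iff (γ : Fin k → ℤ) :
    S.Φ γ ∈ (S.nextΦ α).range ↔ α γ ∈ intLattice m := by
  symm
  rw [← finiteRep_apply_eq_zero, ← AddMonoidHom.mem_ker, ← range_kerBasis]
  constructor
  · rintro ⟨γ', rfl⟩
    exact ⟨γ', rfl⟩
  · rintro ⟨γ', h⟩
    exact ⟨γ', injective_of_det_ne_zero S.det_pos.ne' h⟩

/-- On the sublattice `Φ.range` the old parameter is integral, so the new one agrees there with `α`
mod `ℤ^m`. -/
lemma nextA_Φ_mem_iff (γ : Fin k → ℤ) :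
    S.nextA α (S.Φ γ) ∈ intLattice m ↔ S.Φ γ ∈ (S.nextΦ α).range := by
  rw [Φ_mem_range_nextΦ_iff, nextA, AddMonoidHom.add_apply, lift_apply]
  exact (intLattice m).add_mem_cancel_left (S.a_mem _ ⟨γ, rfl⟩)

lemma nextA_mem {γ : Fin k → ℤ} (h : γ ∈ (S.nextΦ α).range) : S.nextA α γ ∈ intLattice m := by
  obtain ⟨γ, rfl⟩ := S.range_nextΦ_le α h
  exact (S.nextA_Φ_mem_iff α γ).2 h

lemma torusRot_nextA_of_mem {γ γ' : Fin k → ℤ} (h : γ - γ' ∈ (S.nextΦ α).range) (x : Euc q) :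
    torusRot hq (realVec (S.nextA α γ)) x = torusRot hq (realVec (S.nextA α γ')) x := by
  rw [← sub_add_cancel γ γ', map_add, realVec_add, torusRot_add_angle,
    torusRot_realVec_of_mem hq (S.nextA_mem α h)]

lemma nextC_eq {γ γ' : Fin k → ℤ} (h : γ - γ' ∈ (S.nextΦ α).range) :
    S.nextC hq α γ = S.nextC hq α γ' := by
  rw [nextC, nextC, S.c_eq _ _ (S.range_nextΦ_le α h), S.torusRot_nextA_of_mem hq α h]

/-- The direction `dirVec` has trivial stabilizer in the torus, so the rotation parameter must be
integral. -/
lemma mem_range_nextΦ_of_torusRot_eq {γ : Fin k → ℤ} (hγ : γ ∈ S.Φ.range) {t : ℝ} (ht : t ≠ 0)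
    (h : torusRot hq (realVec (S.nextA α γ)) (t • dirVec q) = t • dirVec q) :
    γ ∈ (S.nextΦ α).range := by
  obtain ⟨γ, rfl⟩ := hγ
  rw [← nextA_Φ_mem_iff, mem_intLattice]
  obtain ⟨u, hu, hv⟩ := exists_dirVec_apply q
  choose n hn using exists_int_of_torusRot_eq hq (mul_ne_zero ht hu)
    (fun i => by simp [hv]) h
  refine ⟨n, fun i => ?_⟩
  have := hn i
  simp only [realVec] at this
  exact_mod_cast this

lemma norm_nextC_sub_le (γ : Fin k → ℤ) : ‖S.nextC hq α γ - S.c γ‖ ≤ S.R / 4 := by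
  rw [nextC, add_sub_cancel_left, norm_torusRot, norm_smul, Real.norm_of_nonneg S.R_pos.le]
  have := mul_le_mul_of_nonneg_left (norm_dirVec_le q) S.R_pos.le
  linarith

/-- Centers in different old disks stay apart, since each is displaced by at most `R / 4` and the
old ones are more than `2R` apart. Within one old disk, coincidence means that a rotation fixes
`dirVec`. -/
lemma mem_range_nextΦ_of_nextC_eq {γ γ' : Fin k → ℤ} (h : S.nextC hq α γ = S.nextC hq α γ') :
    γ - γ' ∈ (S.nextΦ α).range := by
  have h0 : γ - γ' ∈ S.Φ.range := by
    by_contra hn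
    have h1 := S.c_sep _ _ hn
    have h2 := S.norm_nextC_sub_le hq α γ
    have h3 := S.norm_nextC_sub_le hq α γ'
    rw [← dist_eq_norm] at h2 h3
    rw [← h] at h3
    have := dist_triangle_left (S.c γ) (S.c γ') (S.nextC hq α γ)
    linarith [S.R_pos]
  refine S.mem_range_nextΦ_of_torusRot_eq hq α h0 S.R_pos.ne' ?_
  rw [nextC, nextC, S.c_eq _ _ h0, add_right_inj] at h
  rw [sub_eq_neg_add, map_add, realVec_add, torusRot_add_angle, h, ← torusRot_add_angle,
    ← realVec_add, ← map_add, neg_add_cancel, map_zero, realVec_zero, torusRot_zero_angle]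

/-- There are only finitely many new centers, so their positive mutual distances have a positive
lower bound. The bound `R / 8` keeps the new disks between the spheres of radius `R / 8` and `3R /
8`, when the offset is exactly `R / 4`. -/
lemma exists_nextR : ∃ ρ > 0, ρ ≤ S.R / 8 ∧ ∀ γ γ', γ - γ' ∉ (S.nextΦ α).range →
    2 * ρ < dist (S.nextC hq α γ) (S.nextC hq α γ') := by
  have := finiteIndex_range (S.det_nextΦ_pos α).ne'
  have hf : (Set.range (S.nextC hq α)).Finite :=
    finite_range_of_const_on_cosets (N := (S.nextΦ α).range) fun _ _ => S.nextC_eq hq α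
  have hf2 : {x | 0 < x ∧ ∃ γ γ', x = dist (S.nextC hq α γ) (S.nextC hq α γ')}.Finite := by
    refine ((hf.prod hf).image fun p => dist p.1 p.2).subset ?_
    rintro x ⟨-, γ, γ', rfl⟩
    exact ⟨(_, _), ⟨⟨γ, rfl⟩, ⟨γ', rfl⟩⟩, rfl⟩
  obtain ⟨ρ, h0, h1, h2⟩ := hf2.exists_pos_lt (fun x hx => hx.1)
    (B := S.R / 8) (by linarith [S.R_pos])
  refine ⟨ρ, h0, h1, fun γ γ' h => h2 _ ⟨dist_pos.2 fun he => h ?_, γ, γ', rfl⟩⟩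
  exact S.mem_range_nextΦ_of_nextC_eq hq α he

/-- The radius of the disks of the next stage. -/
def nextR : ℝ := (S.exists_nextR hq α).choose

lemma nextR_pos : 0 < S.nextR hq α := (S.exists_nextR hq α).choose_spec.1

lemma nextR_le : S.nextR hq α ≤ S.R / 8 := (S.exists_nextR hq α).choose_spec.2.1

/-- The stage that follows `S` if the rotations are prescribed by `α`. -/
def next : Stage k m q where
  Φ := S.nextΦ α
  a := S.nextA α
  c := S.nextC hq α
  R := S.nextR hq α
  det_pos := S.det_nextΦ_pos α
  a_mem _ := S.nextA_mem α
  R_pos := S.nextR_pos hq α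
  c_eq _ _ := S.nextC_eq hq α
  c_sep := (S.exists_nextR hq α).choose_spec.2.2
  norm_add_le γ := by
    have h1 := S.norm_nextC_sub_le hq α γ
    have h2 := S.nextR_le hq α
    have h3 := norm_le_norm_add_norm_sub' (S.nextC hq α γ) (S.c γ)
    linarith [S.norm_add_le γ, S.R_pos]

/-- The first stage: one disk of radius `1 / 2`. -/
def first (k m q : ℕ) : Stage k m q where
  Φ := AddMonoidHom.id _
  a := 0
  c _ := 0
  R := 1 / 2
  det_pos := by
    have : (AddMonoidHom.id (Fin k → ℤ)).toIntLinearMap = LinearMap.id := rfl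
    rw [this, LinearMap.det_id]; norm_num
  a_mem _ _ := zero_mem _
  R_pos := by norm_num
  c_eq _ _ _ := rfl
  c_sep γ γ' h := (h ⟨γ - γ', rfl⟩).elim
  norm_add_le _ := by simp

end Stage

/-! ### The sequence of stages -/

section Stages

variable {k m q : ℕ} (hq : q = 2 * m ∨ q = 2 * m + 1) (α : ℕ → ((Fin k → ℤ) →+ (Fin m → ℚ)))

/-- The sequence of stages defined by a sequence of representations. -/
def stages : ℕ → Stage k m q
  | 0 => Stage.first k m q
  | ℓ + 1 => (stages ℓ).next hq (α ℓ)

/-- Makes it possible to bound `α ℓ` in terms of the preceding representations only. -/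
lemma stages_congr {α α' : ℕ → ((Fin k → ℤ) →+ (Fin m → ℚ))} {ℓ : ℕ}
    (h : ∀ i < ℓ, α i = α' i) : stages hq α ℓ = stages hq α' ℓ := by
  induction ℓ with
  | zero => rfl
  | succ ℓ ih =>
    rw [stages, stages, ih fun i hi => h i (by omega), h ℓ (by omega)]

lemma towerMap_kerBasis (ℓ : ℕ) :
    towerMap (fun ℓ => kerBasis (α ℓ)) ℓ = (stages hq α ℓ).Φ := by
  induction ℓ with
  | zero => rfl
  | succ ℓ ih => rw [towerMap, ih]; rfl

end Stages

/-! ### Displacements supported in the disks of one stage -/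

namespace Stage

variable {k m q : ℕ} (hq : q = 2 * m ∨ q = 2 * m + 1) (S : Stage k m q)
  (α : (Fin k → ℤ) →+ (Fin m → ℚ))

/-- The amount by which the action changes in the disks of the stage `S`. -/
def disp (γ : Fin k → ℤ) (x : Euc q) : Euc q :=
  ∑ p ∈ S.centers, torusRot hq (realVec (S.a γ))
    (twistDiff hq S.R (realVec (S.lift α γ)) (x - p))

variable {S}

lemma sub_mem_range_of_norm_le {x : Euc q} {γ γ' : Fin k → ℤ} (h : ‖x - S.c γ‖ ≤ S.R)
    (h' : ‖x - S.c γ'‖ ≤ S.R) : γ - γ' ∈ S.Φ.range := by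
  by_contra hn
  have := S.c_sep _ _ hn
  rw [← dist_eq_norm] at h h'
  linarith [dist_triangle_left (S.c γ) (S.c γ') x]

lemma c_add_eq {γ γ' : Fin k → ℤ} (h : γ - γ' ∈ S.Φ.range) (γ₀ : Fin k → ℤ) :
    S.c (γ₀ + γ) = S.c (γ₀ + γ') :=
  S.c_eq _ _ (by simpa using h)

/-- The disks of different centers are disjoint, so all but one summand vanish. -/
lemma disp_of_mem {x : Euc q} {γ' : Fin k → ℤ} (h : ‖x - S.c γ'‖ ≤ S.R) (γ : Fin k → ℤ) :
    S.disp hq α γ x = torusRot hq (realVec (S.a γ))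
      (twistDiff hq S.R (realVec (S.lift α γ)) (x - S.c γ')) := by
  rw [disp]
  refine Finset.sum_eq_single_of_mem _ (S.mem_centers.2 ⟨γ', rfl⟩) fun p hp hne => ?_
  obtain ⟨γ'', rfl⟩ := S.mem_centers.1 hp
  rw [twistDiff_of_ge hq S.R_pos, torusRot_apply_zero]
  by_contra hlt
  exact hne (S.c_eq _ _ (sub_mem_range_of_norm_le (not_le.1 hlt).le h))

lemma torusRot_add_disp {x : Euc q} {γ' : Fin k → ℤ} (h : ‖x - S.c γ'‖ ≤ S.R) (γ : Fin k → ℤ) :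
    torusRot hq (realVec (S.a γ)) (x - S.c γ') + S.disp hq α γ x =
      torusRot hq (realVec (S.a γ)) (twist hq S.R (realVec (S.lift α γ)) (x - S.c γ')) := by
  rw [disp_of_mem hq α h, ← torusRot_add, twistDiff, add_sub_cancel]

lemma disp_of_forall {x : Euc q} (h : ∀ γ', S.R ≤ ‖x - S.c γ'‖) (γ : Fin k → ℤ) :
    S.disp hq α γ x = 0 := by
  refine Finset.sum_eq_zero fun _ hp => ?_
  obtain ⟨γ'', rfl⟩ := S.mem_centers.1 hp
  rw [twistDiff_of_ge hq S.R_pos _ (h _), torusRot_apply_zero]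

lemma norm_disp_le (γ : Fin k → ℤ) (x : Euc q) : ‖S.disp hq α γ x‖ ≤ 2 * S.R := by
  by_cases h : ∃ γ', ‖x - S.c γ'‖ ≤ S.R
  · obtain ⟨γ', h⟩ := h
    rw [disp_of_mem hq α h, norm_torusRot]
    exact (norm_twistDiff_le hq _ _ _).trans (by linarith)
  · push Not at h
    rw [disp_of_forall hq α fun γ' => (h γ').le, norm_zero]
    linarith [S.R_pos]

lemma contDiff_disp (n : ℕ∞) (γ : Fin k → ℤ) : ContDiff ℝ n (S.disp hq α γ) :=
  ContDiff.sum fun _ _ => (torusIsom hq (realVec (S.a γ))).toContinuousLinearMap.contDiff.comp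
    ((contDiff_twistDiff hq n S.R _).comp (contDiff_id.sub contDiff_const))

variable (S) in
lemma exists_disp_lipschitz : ∃ C : ℝ, 0 ≤ C ∧ ∀ γ x y,
    ‖S.disp hq α γ x - S.disp hq α γ y‖ ≤ C * ‖realVec (S.lift α γ)‖ * ‖x - y‖ := by
  obtain ⟨C, hC, h⟩ := exists_twistDiff_lipschitz hq S.R_pos
  refine ⟨S.centers.card * C, by positivity, fun γ x y => ?_⟩
  rw [disp, disp, ← Finset.sum_sub_distrib]
  refine (norm_sum_le _ _).trans
    ((Finset.sum_le_sum (g := fun _ => C * ‖realVec (S.lift α γ)‖ * ‖x - y‖) fun p _ => ?_).trans_eq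
      ?_)
  · rw [← torusRot_sub, norm_torusRot]
    simpa using h (realVec (S.lift α γ)) (x - p) (y - p)
  · rw [Finset.sum_const, nsmul_eq_mul]; ring

variable (S) in
-- The rotations in the summands are linear isometries and do not affect the norms; `ρ` therefore
-- works for all `γ` and `α` at once.
lemma exists_disp_small (r : ℕ) {ε : ℝ} (hε : 0 < ε) : ∃ ρ > 0,
    ∀ (α : (Fin k → ℤ) →+ (Fin m → ℚ)) γ, ‖realVec (S.lift α γ)‖ < ρ → ∀ p ≤ r, ∀ x,
      ‖iteratedFDeriv ℝ p (S.disp hq α γ) x‖ ≤ ε := by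
  have hN : (0 : ℝ) < S.centers.card + 1 := by positivity
  obtain ⟨ρ, hρ, h⟩ := exists_twistDiff_small hq S.R_pos r (div_pos hε hN)
  refine ⟨ρ, hρ, fun α γ hb p hp x => ?_⟩
  have e : S.disp hq α γ = ∑ i ∈ S.centers, torusIsom hq (realVec (S.a γ)) ∘ fun x =>
      twistDiff hq S.R (realVec (S.lift α γ)) (x - i) := by
    ext1 y; rw [Finset.sum_apply]; rfl
  have hd : ∀ i : Euc q, ContDiff ℝ p fun x =>
      twistDiff hq S.R (realVec (S.lift α γ)) (x - i) := fun i =>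
    (contDiff_twistDiff hq p S.R _).comp (contDiff_id.sub contDiff_const)
  rw [e, iteratedFDeriv_sum_apply fun i _ => ((torusIsom hq
    (realVec (S.a γ))).contDiff.comp (hd i)).contDiffAt]
  refine (norm_sum_le _ _).trans
    ((Finset.sum_le_sum (g := fun _ => ε / (S.centers.card + 1)) fun i _ => ?_).trans ?_)
  · rw [LinearIsometry.norm_iteratedFDeriv_comp_left _ (hd i).contDiffAt le_rfl,
      iteratedFDeriv_comp_sub]
    exact h _ hb p hp _
  · rw [Finset.sum_const, nsmul_eq_mul, ← mul_div_assoc, div_le_iff₀ hN]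
    nlinarith

end Stage

/-! ### The finite stages of the action -/

section PartialAct

variable {k m q : ℕ} (hq : q = 2 * m ∨ q = 2 * m + 1) (α : ℕ → ((Fin k → ℤ) →+ (Fin m → ℚ)))

lemma stages_R_succ_le (ℓ : ℕ) : (stages hq α (ℓ + 1)).R ≤ (stages hq α ℓ).R / 8 :=
  (stages hq α ℓ).nextR_le hq (α ℓ)

lemma stages_R_le (ℓ : ℕ) : (stages hq α ℓ).R ≤ 1 / 2 * (1 / 8) ^ ℓ := by
  induction ℓ with
  | zero => simp [stages, Stage.first]
  | succ ℓ ih =>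
    refine (stages_R_succ_le hq α ℓ).trans ?_
    rw [pow_succ]; linarith

lemma tendsto_stages_R : Tendsto (fun ℓ => (stages hq α ℓ).R) atTop (𝓝 0) := by
  refine squeeze_zero (fun ℓ => (stages hq α ℓ).R_pos.le) (stages_R_le hq α) ?_
  have := (tendsto_pow_atTop_nhds_zero_of_lt_one (r := (1 / 8 : ℝ))
    (by norm_num) (by norm_num)).const_mul (1 / 2)
  rwa [mul_zero] at this

lemma stages_a_succ (ℓ : ℕ) (γ : Fin k → ℤ) : realVec ((stages hq α (ℓ + 1)).a γ) =
    realVec ((stages hq α ℓ).a γ) + realVec ((stages hq α ℓ).lift (α ℓ) γ) := by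
  rw [← realVec_add]; rfl

lemma stages_c_succ (ℓ : ℕ) (γ : Fin k → ℤ) : (stages hq α (ℓ + 1)).c γ =
    (stages hq α ℓ).c γ + torusRot hq (realVec ((stages hq α (ℓ + 1)).a γ))
      ((stages hq α ℓ).R • dirVec q) := rfl

lemma range_stages_Φ_succ_le (ℓ : ℕ) :
    (stages hq α (ℓ + 1)).Φ.range ≤ (stages hq α ℓ).Φ.range :=
  (stages hq α ℓ).range_nextΦ_le (α ℓ)

lemma norm_stages_c_succ_sub_le (ℓ : ℕ) (γ : Fin k → ℤ) :
    ‖(stages hq α (ℓ + 1)).c γ - (stages hq α ℓ).c γ‖ ≤ (stages hq α ℓ).R / 4 :=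
  (stages hq α ℓ).norm_nextC_sub_le hq (α ℓ) γ

/-- Since `R / 4 + R / 8 ≤ R / 2`, the new disks lie where the old cutoff equals 1. -/
lemma norm_sub_le_of_succ {ℓ : ℕ} {x : Euc q} {γ : Fin k → ℤ}
    (h : ‖x - (stages hq α (ℓ + 1)).c γ‖ ≤ (stages hq α (ℓ + 1)).R) :
    ‖x - (stages hq α ℓ).c γ‖ ≤ (stages hq α ℓ).R / 2 := by
  have h1 := norm_stages_c_succ_sub_le hq α ℓ γ
  have h2 := stages_R_succ_le hq α ℓ
  have h3 := norm_sub_le_norm_sub_add_norm_sub x ((stages hq α (ℓ + 1)).c γ) ((stages hq α ℓ).c γ)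
  linarith [(stages hq α ℓ).R_pos]

/-- The action obtained after the first `n` modifications. -/
def partialAct (n : ℕ) (γ : Fin k → ℤ) (x : Euc q) : Euc q :=
  x + ∑ i ∈ Finset.range n, (stages hq α i).disp hq (α i) γ x

lemma partialAct_succ (n : ℕ) (γ : Fin k → ℤ) (x : Euc q) : partialAct hq α (n + 1) γ x =
    partialAct hq α n γ x + (stages hq α n).disp hq (α n) γ x := by
  rw [partialAct, partialAct, Finset.sum_range_succ, add_assoc]

@[simp] lemma partialAct_zero (γ : Fin k → ℤ) (x : Euc q) : partialAct hq α 0 γ x = x := by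
  simp [partialAct]

/-- Before the modification at stage `ℓ` the disks of this stage move as rigid bodies. -/
lemma partialAct_of_mem {ℓ : ℕ} {x : Euc q} {γ' : Fin k → ℤ}
    (h : ‖x - (stages hq α ℓ).c γ'‖ ≤ (stages hq α ℓ).R) (γ : Fin k → ℤ) :
    partialAct hq α ℓ γ x = (stages hq α ℓ).c (γ + γ') +
      torusRot hq (realVec ((stages hq α ℓ).a γ)) (x - (stages hq α ℓ).c γ') := by
  induction ℓ with
  | zero => simp [stages, Stage.first]
  | succ ℓ ih =>
    have h2 := norm_sub_le_of_succ hq α h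
    have h1 := h2.trans (half_le_self (stages hq α ℓ).R_pos.le)
    -- The offset of the new center is itself rotated by the new parameter of `γ'`; applying `γ`
    -- adds the parameters and gives the offset of the center for `γ + γ'`.
    have e : x - (stages hq α ℓ).c γ' = (x - (stages hq α (ℓ + 1)).c γ') +
        torusRot hq (realVec ((stages hq α (ℓ + 1)).a γ')) ((stages hq α ℓ).R • dirVec q) := by
      rw [stages_c_succ]; abel
    rw [partialAct_succ, ih h1, add_assoc, Stage.torusRot_add_disp hq _ h1,
      twist_of_le hq (stages hq α ℓ).R_pos _ h2, ← torusRot_add_angle, ← stages_a_succ, e, torusRot_add, ← torusRot_add_angle,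
      ← realVec_add, ← map_add, stages_c_succ hq α ℓ (γ + γ')]
    abel

lemma partialAct_succ_of_mem {ℓ : ℕ} {x : Euc q} {γ' : Fin k → ℤ}
    (h : ‖x - (stages hq α ℓ).c γ'‖ ≤ (stages hq α ℓ).R) (γ : Fin k → ℤ) :
    partialAct hq α (ℓ + 1) γ x = (stages hq α ℓ).c (γ + γ') +
      torusRot hq (realVec ((stages hq α ℓ).a γ)) (twist hq (stages hq α ℓ).R
        (realVec ((stages hq α ℓ).lift (α ℓ) γ)) (x - (stages hq α ℓ).c γ')) := by
  rw [partialAct_succ, partialAct_of_mem hq α h, add_assoc, Stage.torusRot_add_disp hq _ h]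

lemma partialAct_succ_of_forall {ℓ : ℕ} {x : Euc q}
    (h : ∀ γ', (stages hq α ℓ).R ≤ ‖x - (stages hq α ℓ).c γ'‖) (γ : Fin k → ℤ) :
    partialAct hq α (ℓ + 1) γ x = partialAct hq α ℓ γ x := by
  rw [partialAct_succ, Stage.disp_of_forall hq _ h, add_zero]

lemma stages_R_le_norm_sub_add {ℓ : ℕ} {x : Euc q}
    (h : ∀ γ', (stages hq α ℓ).R ≤ ‖x - (stages hq α ℓ).c γ'‖) (d : ℕ) (γ' : Fin k → ℤ) :
    (stages hq α (ℓ + d)).R ≤ ‖x - (stages hq α (ℓ + d)).c γ'‖ := by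
  induction d generalizing γ' with
  | zero => exact h γ'
  | succ d ih =>
    by_contra hlt
    linarith [norm_sub_le_of_succ hq α (ℓ := ℓ + d) (γ := γ') (not_le.1 hlt).le, ih γ', (stages hq α (ℓ + d)).R_pos]

/-- Outside the disks of stage `ℓ` no later stage modifies the action, because later disks lie
inside earlier ones. -/
lemma partialAct_add_of_forall {ℓ : ℕ} {x : Euc q}
    (h : ∀ γ', (stages hq α ℓ).R ≤ ‖x - (stages hq α ℓ).c γ'‖) (d : ℕ) (γ : Fin k → ℤ) :
    partialAct hq α (ℓ + d) γ x = partialAct hq α ℓ γ x := by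
  induction d with
  | zero => rfl
  | succ d ih =>
    rw [← add_assoc, partialAct_succ_of_forall hq α (stages_R_le_norm_sub_add hq α h d), ih]

lemma partialAct_zero_left (n : ℕ) (x : Euc q) : partialAct hq α n 0 x = x := by
  induction n with
  | zero => simp
  | succ n ih =>
    by_cases h : ∃ γ', ‖x - (stages hq α n).c γ'‖ ≤ (stages hq α n).R
    · obtain ⟨γ', h⟩ := h
      rw [partialAct_succ_of_mem hq α h, twist]
      simp
    · push Not at h
      rw [partialAct_succ_of_forall hq α fun γ' => (h γ').le, ih]

lemma norm_partialAct_sub {ℓ : ℕ} {x : Euc q} {γ' : Fin k → ℤ}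
    (h : ‖x - (stages hq α ℓ).c γ'‖ ≤ (stages hq α ℓ).R) (γ : Fin k → ℤ) :
    ‖partialAct hq α ℓ γ x - (stages hq α ℓ).c (γ + γ')‖ = ‖x - (stages hq α ℓ).c γ'‖ := by
  rw [partialAct_of_mem hq α h, add_sub_cancel_left, norm_torusRot]

lemma norm_partialAct_succ_sub {ℓ : ℕ} {x : Euc q} {γ' : Fin k → ℤ}
    (h : ‖x - (stages hq α ℓ).c γ'‖ ≤ (stages hq α ℓ).R) (γ : Fin k → ℤ) :
    ‖partialAct hq α (ℓ + 1) γ x - (stages hq α ℓ).c (γ + γ')‖ =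
      ‖x - (stages hq α ℓ).c γ'‖ := by
  rw [partialAct_succ_of_mem hq α h, add_sub_cancel_left, norm_torusRot, norm_twist]

/-- Inside a disk of the last stage the twist parameters add. Outside all of them the previous
action applies, once the image is known to lie outside as well. -/
lemma partialAct_add (n : ℕ) (γ γ' : Fin k → ℤ) (x : Euc q) :
    partialAct hq α n (γ + γ') x = partialAct hq α n γ (partialAct hq α n γ' x) := by
  induction n generalizing γ γ' x with
  | zero => simp
  | succ n ih =>
    by_cases h : ∃ γ'', ‖x - (stages hq α n).c γ''‖ ≤ (stages hq α n).R
    · obtain ⟨γ'', h⟩ := h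
      have h1 := (norm_partialAct_succ_sub hq α h γ').trans_le h
      rw [partialAct_succ_of_mem hq α h1, partialAct_succ_of_mem hq α h,
        partialAct_succ_of_mem hq α h, add_sub_cancel_left, twist_torusRot_twist,
        ← torusRot_add_angle, map_add, map_add, realVec_add, realVec_add, add_assoc]
    · push Not at h
      have h1 : ∀ γ'', (stages hq α n).R ≤
          ‖partialAct hq α n γ' x - (stages hq α n).c γ''‖ := by
        intro γ''
        by_contra hlt
        -- Otherwise `-γ'`, which permutes the disks, would carry the image back to `x` inside a
        -- disk.
        have h2 := norm_partialAct_sub hq α (not_le.1 hlt).le (-γ')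
        rw [← ih, neg_add_cancel, partialAct_zero_left] at h2
        exact absurd (h2 ▸ h _) (not_lt.2 (not_le.1 hlt).le)
      rw [partialAct_succ_of_forall hq α fun γ' => (h γ').le,
        partialAct_succ_of_forall hq α fun γ' => (h γ').le, partialAct_succ_of_forall hq α h1, ih]

/-- The disks of stage `ℓ` are permuted by all later stages of the action. -/
lemma norm_partialAct_sub_le (d : ℕ) {ℓ : ℕ} {x : Euc q} {γ' : Fin k → ℤ}
    (h : ‖x - (stages hq α ℓ).c γ'‖ ≤ (stages hq α ℓ).R) (γ : Fin k → ℤ) :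
    ‖partialAct hq α (ℓ + d) γ x - (stages hq α ℓ).c (γ + γ')‖ ≤
      max ‖x - (stages hq α ℓ).c γ'‖ ((stages hq α ℓ).R / 2) := by
  -- The induction raises `ℓ`: a point in a disk of stage `ℓ + 1` remains in such a disk, hence
  -- within `R / 2` of a center of stage `ℓ`; any other point is never modified after stage `ℓ`,
  -- which preserves its distance to the center.
  induction d generalizing ℓ γ' with
  | zero => exact le_max_of_le_left (norm_partialAct_sub hq α h γ).le
  | succ d ih =>
    by_cases h1 : ∃ γ'', ‖x - (stages hq α (ℓ + 1)).c γ''‖ ≤ (stages hq α (ℓ + 1)).R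
    · obtain ⟨γ'', h1⟩ := h1
      have h2 := (ih h1).trans (max_le h1 (half_le_self (stages hq α (ℓ + 1)).R_pos.le))
      have h3 := norm_sub_le_of_succ hq α h2
      have h4 := norm_sub_le_of_succ hq α h1
      have h5 := Stage.sub_mem_range_of_norm_le h
        (h4.trans (half_le_self (stages hq α ℓ).R_pos.le))
      rw [Stage.c_add_eq h5, ← add_assoc, add_right_comm]
      exact le_max_of_le_right h3
    · push Not at h1
      rw [← add_assoc, add_right_comm, partialAct_add_of_forall hq α fun γ' => (h1 γ').le,
        norm_partialAct_succ_sub hq α h]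
      exact le_max_left _ _

end PartialAct

/-! ### The limit action -/

section LimitAct

variable {k m q : ℕ} (hq : q = 2 * m ∨ q = 2 * m + 1) (α : ℕ → ((Fin k → ℤ) →+ (Fin m → ℚ)))

lemma contDiff_partialAct (n : ℕ∞) (ℓ : ℕ) (γ : Fin k → ℤ) :
    ContDiff ℝ n (partialAct hq α ℓ γ) :=
  contDiff_id.add (ContDiff.sum fun i _ => Stage.contDiff_disp hq (α i) n γ)

/-- The finite stages of the action preserve volume. -/
lemma det_fderiv_partialAct (ℓ : ℕ) (γ : Fin k → ℤ) (x : Euc q) :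
    (fderiv ℝ (partialAct hq α ℓ γ) x).det = 1 := by
  induction ℓ with
  | zero =>
    have : partialAct hq α 0 γ = id := by ext1 x; simp
    rw [this, fderiv_id, ContinuousLinearMap.det]
    exact LinearMap.det_id
  | succ ℓ ih =>
    by_cases h : ∃ γ', ‖x - (stages hq α ℓ).c γ'‖ ≤ (stages hq α ℓ).R
    · obtain ⟨γ', h⟩ := h
      set S := stages hq α ℓ
      set D := Metric.closedBall (S.c γ') S.R
      have hx : x ∈ D := by simpa [D, dist_eq_norm] using h
      -- Derivatives within a closed ball are unique, so the formula valid on `D` determines the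
      -- derivative even at its boundary points.
      have hu : UniqueDiffWithinAt ℝ D x := by
        refine uniqueDiffOn_convex (convex_closedBall _ _) ?_ x hx
        rw [interior_closedBall _ S.R_pos.ne']
        exact Metric.nonempty_ball.2 S.R_pos
      set b := realVec (S.lift (α ℓ) γ)
      have h1 : HasFDerivAt (fun x => S.c (γ + γ') + torusIsom hq (realVec (S.a γ))
          (twist hq S.R b (x - S.c γ'))) ((torusIsom hq (realVec (S.a γ))).toContinuousLinearMap.comp
            (fderiv ℝ (twist hq S.R b) (x - S.c γ'))) x := by
        have ht : DifferentiableAt ℝ (twist hq S.R b) (x - S.c γ') := by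
          have e : twist hq S.R b = fun y => twistDiff hq S.R b y + y := by
            ext1 y; rw [twistDiff, sub_add_cancel]
          rw [e]
          exact ((contDiff_twistDiff hq 1 S.R b).differentiable one_ne_zero _).add
            differentiableAt_id
        refine HasFDerivAt.const_add _ ?_
        refine (torusIsom hq (realVec (S.a γ))).toContinuousLinearMap.hasFDerivAt.comp
          (f := fun x => twist hq S.R b (x - S.c γ')) x ?_
        have := ht.hasFDerivAt.comp (f := fun x => x - S.c γ') x
          ((hasFDerivAt_id x).sub_const (S.c γ'))
        rwa [ContinuousLinearMap.comp_id] at this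
      have h2 : HasFDerivWithinAt (partialAct hq α (ℓ + 1) γ) _ D x :=
        h1.hasFDerivWithinAt.congr (fun y hy => partialAct_succ_of_mem hq α
          (by simpa [D, dist_eq_norm] using hy) γ) (partialAct_succ_of_mem hq α h γ)
      have h3 : HasFDerivWithinAt (partialAct hq α (ℓ + 1) γ) _ D x :=
        ((contDiff_partialAct hq α 1 (ℓ + 1) γ).differentiable
          one_ne_zero x).hasFDerivAt.hasFDerivWithinAt
      rw [hu.eq h3 h2, ContinuousLinearMap.det]
      change LinearMap.det ((torusIsom hq (realVec (S.a γ))).toLinearMap ∘ₗ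
        (fderiv ℝ (twist hq S.R b) (x - S.c γ')).toLinearMap) = 1
      rw [LinearMap.det_comp, det_torusIsom, one_mul]
      exact det_fderiv_twist hq S.R b _
    · push Not at h
      have : partialAct hq α (ℓ + 1) γ =ᶠ[𝓝 x] partialAct hq α ℓ γ := by
        -- Finiteness of the set of centers makes the complement of the closed disks open.
        have h1 : ∀ᶠ y in 𝓝 x, ∀ p ∈ (stages hq α ℓ).centers, (stages hq α ℓ).R < ‖y - p‖ := by
          refine (eventually_all_finset _).2 fun p hp => ?_
          obtain ⟨γ', rfl⟩ := (stages hq α ℓ).mem_centers.1 hp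
          exact (isOpen_lt continuous_const (by fun_prop)).mem_nhds (h γ')
        filter_upwards [h1] with y hy
        exact partialAct_succ_of_forall hq α
          (fun γ' => (hy _ ((stages hq α ℓ).mem_centers.2 ⟨γ', rfl⟩)).le) γ
      rw [this.fderiv_eq, ih]

/-- The limit of the finite stages of the action. -/
def limAct (γ : Fin k → ℤ) (x : Euc q) : Euc q := x + ∑' i, (stages hq α i).disp hq (α i) γ x

lemma norm_stages_disp_le (i : ℕ) (γ : Fin k → ℤ) (x : Euc q) :
    ‖(stages hq α i).disp hq (α i) γ x‖ ≤ (1 / 8) ^ i := by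
  refine (Stage.norm_disp_le hq _ _ _).trans ?_
  linarith [stages_R_le hq α i]

lemma summable_pow_eighth : Summable fun i : ℕ => (1 / 8 : ℝ) ^ i :=
  summable_geometric_of_lt_one (by norm_num) (by norm_num)

lemma continuous_limAct (γ : Fin k → ℤ) : Continuous (limAct hq α γ) :=
  continuous_id.add (continuous_tsum
    (fun i => (Stage.contDiff_disp hq (α i) 0 γ).continuous) summable_pow_eighth
    fun i x => norm_stages_disp_le hq α i γ x)

lemma tendstoUniformly_partialAct (γ : Fin k → ℤ) :
    TendstoUniformly (fun n => partialAct hq α n γ) (limAct hq α γ) atTop := by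
  have h := tendstoUniformly_tsum_nat summable_pow_eighth (norm_stages_disp_le hq α · γ ·)
  rw [Metric.tendstoUniformly_iff] at h ⊢
  simpa [limAct, partialAct] using h

lemma tendsto_partialAct (γ : Fin k → ℤ) (x : Euc q) :
    Tendsto (fun n => partialAct hq α n γ x) atTop (𝓝 (limAct hq α γ x)) :=
  (tendstoUniformly_partialAct hq α γ).tendsto_at x

lemma limAct_zero (x : Euc q) : limAct hq α 0 x = x := by
  refine tendsto_nhds_unique (tendsto_partialAct hq α 0 x) ?_
  simp only [partialAct_zero_left]
  exact tendsto_const_nhds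

/-- Uniform convergence and continuity of the limit allow passing to the limit in the composition.
-/
lemma limAct_add (γ γ' : Fin k → ℤ) (x : Euc q) :
    limAct hq α (γ + γ') x = limAct hq α γ (limAct hq α γ' x) := by
  refine tendsto_nhds_unique (tendsto_partialAct hq α _ x) ?_
  simp only [partialAct_add]
  exact (tendstoUniformly_partialAct hq α γ).tendsto_comp
    (continuous_limAct hq α γ).continuousAt (tendsto_partialAct hq α γ' x)

lemma limAct_of_forall {ℓ : ℕ} {x : Euc q}
    (h : ∀ γ', (stages hq α ℓ).R ≤ ‖x - (stages hq α ℓ).c γ'‖) (γ : Fin k → ℤ) :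
    limAct hq α γ x = partialAct hq α ℓ γ x := by
  refine tendsto_nhds_unique ((tendsto_partialAct hq α γ x).comp (tendsto_add_atTop_nat ℓ)) ?_
  have : ∀ n, (fun n => partialAct hq α n γ x) (n + ℓ) = partialAct hq α ℓ γ x := fun n => by
    rw [add_comm]; exact partialAct_add_of_forall hq α h n γ
  simp only [Function.comp_def, this]
  exact tendsto_const_nhds

lemma norm_limAct_sub_le {ℓ : ℕ} {x : Euc q} {γ' : Fin k → ℤ}
    (h : ‖x - (stages hq α ℓ).c γ'‖ ≤ (stages hq α ℓ).R) (γ : Fin k → ℤ) :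
    ‖limAct hq α γ x - (stages hq α ℓ).c (γ + γ')‖ ≤
      max ‖x - (stages hq α ℓ).c γ'‖ ((stages hq α ℓ).R / 2) := by
  refine le_of_tendsto (((tendsto_partialAct hq α γ x).comp
    (tendsto_add_atTop_nat ℓ)).sub_const _).norm (Eventually.of_forall fun n => ?_)
  have := norm_partialAct_sub_le hq α n h γ
  simpa only [Function.comp_apply, add_comm ℓ n] using this

lemma norm_limAct_sub_lt {ℓ : ℕ} {x : Euc q} {γ' : Fin k → ℤ}
    (h : ‖x - (stages hq α ℓ).c γ'‖ < (stages hq α ℓ).R) (γ : Fin k → ℤ) :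
    ‖limAct hq α γ x - (stages hq α ℓ).c (γ + γ')‖ < (stages hq α ℓ).R :=
  (norm_limAct_sub_le hq α h.le γ).trans_lt (max_lt h (half_lt_self (stages hq α ℓ).R_pos))

lemma limAct_neg_limAct (γ : Fin k → ℤ) (x : Euc q) :
    limAct hq α (-γ) (limAct hq α γ x) = x := by
  rw [← limAct_add, neg_add_cancel, limAct_zero]

lemma limAct_limAct_neg (γ : Fin k → ℤ) (x : Euc q) :
    limAct hq α γ (limAct hq α (-γ) x) = x := by
  rw [← limAct_add, add_neg_cancel, limAct_zero]

lemma forall_le_norm_limAct_sub {ℓ : ℕ} {x : Euc q}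
    (h : ∀ γ', (stages hq α ℓ).R ≤ ‖x - (stages hq α ℓ).c γ'‖) (γ γ' : Fin k → ℤ) :
    (stages hq α ℓ).R ≤ ‖limAct hq α γ x - (stages hq α ℓ).c γ'‖ := by
  by_contra hlt
  have := norm_limAct_sub_lt hq α (not_le.1 hlt) (-γ)
  rw [limAct_neg_limAct] at this
  exact absurd (h _) (not_le.2 this)

/-- In the part of a disk that is not modified any more, the distance to the center is
preserved. -/
lemma norm_limAct_sub_eq {ℓ : ℕ} {x : Euc q} {γ' : Fin k → ℤ}
    (h : ‖x - (stages hq α ℓ).c γ'‖ ≤ (stages hq α ℓ).R)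
    (h' : ∀ γ', (stages hq α (ℓ + 1)).R ≤ ‖x - (stages hq α (ℓ + 1)).c γ'‖) (γ : Fin k → ℤ) :
    ‖limAct hq α γ x - (stages hq α ℓ).c (γ + γ')‖ = ‖x - (stages hq α ℓ).c γ'‖ := by
  rw [limAct_of_forall hq α h', norm_partialAct_succ_sub hq α h]

lemma forall_le_norm_sub_of_norm_ge {x : Euc q} (h : 1 / 2 ≤ ‖x‖) (γ' : Fin k → ℤ) :
    (stages hq α 0).R ≤ ‖x - (stages hq α 0).c γ'‖ := by
  simpa [stages, Stage.first] using h

lemma limAct_of_norm_ge {x : Euc q} (h : 1 / 2 ≤ ‖x‖) (γ : Fin k → ℤ) : limAct hq α γ x = x := by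
  rw [limAct_of_forall hq α (forall_le_norm_sub_of_norm_ge hq α h), partialAct_zero]

lemma norm_limAct_le_one {x : Euc q} (h : ‖x‖ ≤ 1) (γ : Fin k → ℤ) : ‖limAct hq α γ x‖ ≤ 1 := by
  rcases le_total (1 / 2) ‖x‖ with h1 | h1
  · rwa [limAct_of_norm_ge hq α h1]
  · have := norm_limAct_sub_le hq α (ℓ := 0) (x := x) (γ' := 0)
      (by simpa [stages, Stage.first] using h1) γ
    simp only [stages, Stage.first, sub_zero] at this
    exact this.trans (max_le h (by norm_num))

/-- The cores of the disks of stage `ℓ` avoid the disks of stage `ℓ + 1`. -/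
lemma stages_R_le_of_norm_sub_lt (hq0 : 0 < q) {ℓ : ℕ} {x : Euc q} {γ' : Fin k → ℤ}
    (h : ‖x - (stages hq α ℓ).c γ'‖ < (stages hq α ℓ).R / 8) (γ'' : Fin k → ℤ) :
    (stages hq α (ℓ + 1)).R ≤ ‖x - (stages hq α (ℓ + 1)).c γ''‖ := by
  by_contra hlt
  have hlt := not_le.1 hlt
  have h0 := norm_sub_le_of_succ hq α hlt.le
  have hR := (stages hq α ℓ).R_pos
  have h1 : (stages hq α ℓ).c γ' = (stages hq α ℓ).c γ'' :=
    (stages hq α ℓ).c_eq _ _ (Stage.sub_mem_range_of_norm_le (x := x) (by linarith) (by linarith))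
  -- The distance is exactly `R / 4` because `q > 0`; a common point would make it less than `R / 8
  -- + R / 8`.
  have h2 : ‖(stages hq α (ℓ + 1)).c γ'' - (stages hq α ℓ).c γ''‖ = (stages hq α ℓ).R / 4 := by
    rw [stages_c_succ, add_sub_cancel_left, norm_torusRot, norm_smul, norm_dirVec hq0,
      Real.norm_of_nonneg hR.le]
    ring
  rw [h1] at h
  have h3 := stages_R_succ_le hq α ℓ
  have h4 := norm_sub_le_norm_sub_add_norm_sub ((stages hq α (ℓ + 1)).c γ'') x
    ((stages hq α ℓ).c γ'')
  rw [norm_sub_rev _ x] at h4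
  linarith

/-- In the core of the disks of stage `ℓ` the action is by rotations. -/
lemma limAct_of_norm_sub_lt (hq0 : 0 < q) {ℓ : ℕ} {x : Euc q} {γ' : Fin k → ℤ}
    (h : ‖x - (stages hq α ℓ).c γ'‖ < (stages hq α ℓ).R / 8) (γ : Fin k → ℤ) :
    limAct hq α γ x = (stages hq α ℓ).c (γ + γ') +
      torusRot hq (realVec ((stages hq α (ℓ + 1)).a γ)) (x - (stages hq α ℓ).c γ') := by
  have hR := (stages hq α ℓ).R_pos
  rw [limAct_of_forall hq α (stages_R_le_of_norm_sub_lt hq α hq0 h),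
    partialAct_succ_of_mem hq α (by linarith), twist_of_le hq hR _ (by linarith),
    ← torusRot_add_angle, stages_a_succ]

/-- The Lipschitz constants of the finite stages grow at most linearly along a cyclic group. -/
lemma exists_partialAct_lipschitz (ℓ : ℕ) (γ : Fin k → ℤ) : ∃ C : ℝ, 0 ≤ C ∧ ∀ (n : ℕ) x y,
    ‖partialAct hq α ℓ (n • γ) x - partialAct hq α ℓ (n • γ) y‖ ≤ C * (n + 1) * ‖x - y‖ := by
  induction ℓ with
  | zero =>
    refine ⟨1, zero_le_one, fun n x y => ?_⟩
    simp only [partialAct_zero, one_mul]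
    exact le_mul_of_one_le_left (norm_nonneg _) (by linarith [n.cast_nonneg (α := ℝ)])
  | succ ℓ ih =>
    obtain ⟨C, hC, h⟩ := ih
    obtain ⟨C', hC', h'⟩ := (stages hq α ℓ).exists_disp_lipschitz hq (α ℓ)
    refine ⟨C + C' * ‖realVec ((stages hq α ℓ).lift (α ℓ) γ)‖, by positivity, fun n x y => ?_⟩
    rw [partialAct_succ, partialAct_succ, add_sub_add_comm]
    refine (norm_add_le _ _).trans ((add_le_add (h n x y) (h' (n • γ) x y)).trans ?_)
    -- The twist parameter of `n • γ` is `n` times that of `γ`, so every stage adds a term linear in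
    -- `n`.
    rw [map_nsmul, realVec_nsmul, norm_smul, Real.norm_of_nonneg n.cast_nonneg]
    have : 0 ≤ C' * ‖realVec ((stages hq α ℓ).lift (α ℓ) γ)‖ * ‖x - y‖ := by positivity
    linarith

end LimitAct

/-! ### Smoothness of the limit action -/

/-- Inverses of generators are included because they too must be `C^r`. The bound `1 / 2` later
excludes non-zero integral values of `α` on generators. -/
lemma Stage.exists_rate {k m q : ℕ} (hq : q = 2 * m ∨ q = 2 * m + 1) (S : Stage k m q) (r : ℕ)
    {ε : ℝ} (hε : 0 < ε) : ∃ η > 0, η ≤ 1 / 2 ∧ ∀ α : (Fin k → ℤ) →+ (Fin m → ℚ),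
      (∀ j, ratNorm (α (gen j)) < η) → ∀ j, ∀ γ, γ = gen j ∨ γ = -gen j →
        ∀ p ≤ r, ∀ x, ‖iteratedFDeriv ℝ p (S.disp hq α γ) x‖ ≤ ε := by
  obtain ⟨ρ, hρ, h⟩ := S.exists_disp_small hq r hε
  obtain ⟨C, hC, hl⟩ := S.exists_lift_le
  -- The constant `C` is the cost of `lift`; the factor 2 turns its non-strict bound into a strict
  -- one.
  refine ⟨min (1 / 2) (ρ / (2 * C)), by positivity, min_le_left _ _, fun α hα j γ hγ => ?_⟩
  refine h α γ ?_
  have h1 : ∀ i, |((S.lift α (gen j) i : ℚ) : ℝ)| < ρ := fun i => by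
    have h2 := hl α (ρ / (2 * C)) (fun j i => (abs_apply_le_ratNorm _ i).trans
      ((hα j).le.trans (min_le_right _ _))) j i
    have h3 : C * (ρ / (2 * C)) = ρ / 2 := by field_simp
    linarith
  have h2 : ‖realVec (S.lift α (gen j))‖ < ρ := (pi_norm_lt_iff hρ).2 h1
  rcases hγ with rfl | rfl
  · exact h2
  · rwa [map_neg, realVec_neg, norm_neg]

section Smooth

variable {k m q : ℕ} (hq : q = 2 * m ∨ q = 2 * m + 1) (α : ℕ → ((Fin k → ℤ) →+ (Fin m → ℚ)))

/-- The displacements of all stages by `γ` are `C^r` small, with geometrically decaying bounds. -/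
def SmallDisp (r : ℕ) (δ : ℝ) (γ : Fin k → ℤ) : Prop :=
  ∀ ℓ, ∀ p ≤ r, ∀ x, ‖iteratedFDeriv ℝ p ((stages hq α ℓ).disp hq (α ℓ) γ) x‖ ≤
    δ / 4 * (1 / 2) ^ ℓ

variable {hq α} {r : ℕ} {δ : ℝ} {γ : Fin k → ℤ}

lemma hasSum_smallDisp_bound (δ : ℝ) : HasSum (fun ℓ : ℕ => δ / 4 * (1 / 2 : ℝ) ^ ℓ) (δ / 2) := by
  have := hasSum_geometric_two.mul_left (δ / 4)
  rwa [show δ / 4 * 2 = δ / 2 by ring] at this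

namespace SmallDisp

lemma contDiff_tsum_disp (hs : SmallDisp hq α r δ γ) :
    ContDiff ℝ r fun x => ∑' i, (stages hq α i).disp hq (α i) γ x :=
  contDiff_tsum (N := (r : ℕ∞)) (v := fun _ ℓ => δ / 4 * (1 / 2 : ℝ) ^ ℓ)
    (fun i => Stage.contDiff_disp hq (α i) r γ) (fun _ _ => (hasSum_smallDisp_bound δ).summable)
    fun p i x hp => hs i p (by exact_mod_cast hp) x

lemma contDiff_limAct (hs : SmallDisp hq α r δ γ) : ContDiff ℝ r (limAct hq α γ) :=
  contDiff_id.add hs.contDiff_tsum_disp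

lemma norm_iteratedFDeriv_le (hs : SmallDisp hq α r δ γ) {p : ℕ} (hp : p ≤ r) (x : Euc q) :
    ‖iteratedFDeriv ℝ p (fun y => limAct hq α γ y - y) x‖ ≤ δ / 2 := by
  have e : (fun y => limAct hq α γ y - y) =
      fun x => ∑' i, (stages hq α i).disp hq (α i) γ x := by
    ext1 y; rw [limAct, add_sub_cancel_left]
  rw [e, iteratedFDeriv_tsum_apply (N := (r : ℕ∞)) (v := fun _ ℓ => δ / 4 * (1 / 2 : ℝ) ^ ℓ)
    (fun i => Stage.contDiff_disp hq (α i) r γ) (fun _ _ => (hasSum_smallDisp_bound δ).summable)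
    (fun p i x hp => hs i p (by exact_mod_cast hp) x) (by exact_mod_cast hp)]
  exact tsum_of_norm_bounded (hasSum_smallDisp_bound δ) fun i => hs i p hp x

/-- The derivatives of the finite stages converge to that of the limit, and the determinant is
continuous. -/
lemma det_fderiv_limAct (hs : SmallDisp hq α r δ γ) (hr : 1 ≤ r) (x : Euc q) :
    (fderiv ℝ (limAct hq α γ) x).det = 1 := by
  have hb : ∀ i y, ‖fderiv ℝ ((stages hq α i).disp hq (α i) γ) y‖ ≤ δ / 4 * (1 / 2 : ℝ) ^ i :=
    fun i y => by rw [← norm_iteratedFDeriv_one]; exact hs i 1 hr y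
  have hd : ∀ i, Differentiable ℝ ((stages hq α i).disp hq (α i) γ) := fun i =>
    (Stage.contDiff_disp hq (α i) 1 γ).differentiable one_ne_zero
  have hsum : Summable fun i => fderiv ℝ ((stages hq α i).disp hq (α i) γ) x :=
    .of_norm_bounded (hasSum_smallDisp_bound δ).summable fun i => hb i x
  have h0 : Summable fun i => (stages hq α i).disp hq (α i) γ 0 :=
    .of_norm_bounded summable_pow_eighth fun i => norm_stages_disp_le hq α i γ 0
  have h1 : fderiv ℝ (limAct hq α γ) x = ContinuousLinearMap.id ℝ _ +
      ∑' i, fderiv ℝ ((stages hq α i).disp hq (α i) γ) x := by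
    have e : limAct hq α γ = id + fun y => ∑' i, (stages hq α i).disp hq (α i) γ y := rfl
    rw [e, fderiv_add differentiableAt_id (hs.contDiff_tsum_disp.differentiable
      (by exact_mod_cast (by omega : r ≠ 0)) x), fderiv_id,
      fderiv_tsum_apply (hasSum_smallDisp_bound δ).summable hd hb h0]
  have h2 : ∀ n, fderiv ℝ (partialAct hq α n γ) x = ContinuousLinearMap.id ℝ _ +
      ∑ i ∈ Finset.range n, fderiv ℝ ((stages hq α i).disp hq (α i) γ) x := fun n => by
    have e : partialAct hq α n γ =
        id + ∑ i ∈ Finset.range n, (stages hq α i).disp hq (α i) γ := by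
      ext1 y; simp [partialAct]
    rw [e, fderiv_add differentiableAt_id (DifferentiableAt.sum fun i _ => hd i x), fderiv_id,
      fderiv_sum fun i _ => hd i x]
  have h3 : Tendsto (fun n => (fderiv ℝ (partialAct hq α n γ) x).det) atTop
      (𝓝 (fderiv ℝ (limAct hq α γ) x).det) := by
    simp only [h1, h2]
    exact (ContinuousLinearMap.continuous_det.tendsto _).comp
      (tendsto_const_nhds.add hsum.hasSum.tendsto_sum_nat)
  simp only [det_fderiv_partialAct] at h3
  exact (tendsto_nhds_unique h3 tendsto_const_nhds)

end SmallDisp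

/-! ### The action on the disk -/

variable (hq α)

/-- The permutation of the disk by which `γ` acts. -/
def diskPerm (γ : Fin k → ℤ) : Equiv.Perm (Disk q) where
  toFun x := ⟨limAct hq α γ x, by
    simpa using norm_limAct_le_one hq α (mem_closedBall_zero_iff.1 x.2) γ⟩
  invFun x := ⟨limAct hq α (-γ) x, by
    simpa using norm_limAct_le_one hq α (mem_closedBall_zero_iff.1 x.2) (-γ)⟩
  left_inv x := Subtype.ext (limAct_neg_limAct hq α γ x)
  right_inv x := Subtype.ext (limAct_limAct_neg hq α γ x)

/-- Off the disk both maps are the identity, so smoothness on all of `ℝ^q` applies. -/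
lemma diskMap_diskPerm (γ : Fin k → ℤ) : diskMap (diskPerm hq α γ) = limAct hq α γ := by
  ext1 x
  by_cases hx : x ∈ Metric.closedBall (0 : Euc q) 1
  · exact diskMap_coe _ ⟨x, hx⟩
  · rw [diskMap, Function.extend_apply' _ _ _ fun ⟨y, hy⟩ => hx (hy ▸ y.2)]
    rw [limAct_of_norm_ge hq α, id]
    simp at hx
    linarith

/-- The action of `ℤ^k` on the disk by bijections. -/
def diskPermHom : Multiplicative (Fin k → ℤ) →* Equiv.Perm (Disk q) where
  toFun γ := diskPerm hq α γ.toAdd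
  map_one' := Equiv.ext fun x => Subtype.ext (limAct_zero hq α x)
  map_mul' γ γ' := Equiv.ext fun x => Subtype.ext (limAct_add hq α γ.toAdd γ'.toAdd x)

variable {hq α}

/-- Only generators and their inverses have controlled derivatives; the other elements are products
of these. -/
lemma diskPermHom_mem (hs : ∀ j, SmallDisp hq α r δ (gen j) ∧ SmallDisp hq α r δ (-gen j))
    (γ : Multiplicative (Fin k → ℤ)) : diskPermHom hq α γ ∈ DiffDisk q r := by
  have hg : ∀ j : Fin k, Multiplicative.ofAdd (gen j) ∈ (DiffDisk q r).comap (diskPermHom hq α) := by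
    intro j
    refine ⟨?_, ?_⟩
    · change ContDiffOn ℝ r (diskMap (diskPerm hq α (gen j))) _
      rw [diskMap_diskPerm]
      exact (hs j).1.contDiff_limAct.contDiffOn
    · change ContDiffOn ℝ r (diskMap (diskPerm hq α (-gen j))) _
      rw [diskMap_diskPerm]
      exact (hs j).2.contDiff_limAct.contDiffOn
  have h : γ ∈ (DiffDisk q r).comap (diskPermHom hq α) := by
    have e : γ = ∏ j, Multiplicative.ofAdd (gen j) ^ (γ.toAdd j) := by
      conv_lhs => rw [← ofAdd_toAdd γ, eq_sum_gen γ.toAdd]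
      rfl
    rw [e]
    exact Subgroup.prod_mem _ fun j _ => Subgroup.zpow_mem _ (hg j) _
  exact h

/-- The action of `ℤ^k` on the disk by diffeomorphisms. -/
def diskAct (hs : ∀ j, SmallDisp hq α r δ (gen j) ∧ SmallDisp hq α r δ (-gen j)) :
    Multiplicative (Fin k → ℤ) →* DiffDisk q r :=
  (diskPermHom hq α).codRestrict _ (diskPermHom_mem hs)

variable (hs : ∀ j, SmallDisp hq α r δ (gen j) ∧ SmallDisp hq α r δ (-gen j))

lemma act_diskAct (γ : Fin k → ℤ) : act (diskAct hs) γ = diskPerm hq α γ := rfl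

lemma act_diskAct_coe (γ : Fin k → ℤ) (x : Disk q) :
    (act (diskAct hs) γ x : Euc q) = limAct hq α γ x := rfl

lemma uniqueDiffOn_disk (q : ℕ) : UniqueDiffOn ℝ (Metric.closedBall (0 : Euc q) 1) := by
  refine uniqueDiffOn_convex (convex_closedBall _ _) ?_
  rw [interior_closedBall _ one_ne_zero]
  exact Metric.nonempty_ball.2 one_pos

lemma crCloseToId_act (hδ : 0 < δ) (j : Fin k) : CrCloseToId r δ (act (diskAct hs) (gen j)) := by
  intro p hp x hx
  rw [act_diskAct, diskMap_diskPerm, iteratedFDerivWithin_eq_iteratedFDeriv (uniqueDiffOn_disk q)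
    (((hs j).1.contDiff_limAct.sub contDiff_fun_id).contDiffAt.of_le (by exact_mod_cast hp)) hx]
  exact ((hs j).1.norm_iteratedFDeriv_le hp x).trans_lt (by linarith)

lemma preservesVolumeForm_act (hr : 1 ≤ r) (j : Fin k) :
    PreservesVolumeForm (act (diskAct hs) (gen j)) := by
  intro x hx
  rw [act_diskAct, diskMap_diskPerm, fderivWithin_eq_fderiv (uniqueDiffOn_disk q x hx)
    ((hs j).1.contDiff_limAct.differentiable (by exact_mod_cast (by omega : r ≠ 0)) x)]
  have h := (hs j).1.det_fderiv_limAct hr x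
  ext v
  rw [stdVolumeForm, AlternatingMap.compLinearMap_apply]
  have := (EuclideanSpace.basisFun (Fin q) ℝ).toBasis.det_comp
    (fderiv ℝ (limAct hq α (gen j)) x : Euc q →ₗ[ℝ] Euc q) v
  rw [ContinuousLinearMap.det] at h
  rw [h, one_mul] at this
  exact this

lemma isIdNearBoundary_act (j : Fin k) : IsIdNearBoundary (act (diskAct hs) (gen j)) := by
  refine ⟨{x | 1 / 2 < ‖(x : Euc q)‖}, isOpen_lt continuous_const (by fun_prop),
    fun x hx => ?_, fun x hx => Subtype.ext (limAct_of_norm_ge hq α (le_of_lt hx) _)⟩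
  have : ‖(x : Euc q)‖ = 1 := hx
  change 1 / 2 < ‖(x : Euc q)‖
  rw [this]; norm_num

end Smooth

/-! ### Zero entropy -/

lemma expGrowthSup_polynomial_le (A d : ℕ) :
    ExpGrowth.expGrowthSup (fun n : ℕ => ((A * (n + 1) ^ d : ℕ) : ENNReal)) ≤ 0 := by
  rw [← EReal.le_of_forall_lt_iff_le]
  intro b hb
  have hb : 0 < b := by exact_mod_cast hb
  refine Eventually.expGrowthSup_le ?_
  have h0 : Tendsto (fun n : ℕ => (n : ℝ) + 1) atTop atTop :=
    tendsto_atTop_add_const_right _ _ tendsto_natCast_atTop_atTop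
  have h1 := ((isLittleO_pow_exp_pos_mul_atTop d hb).const_mul_left (A : ℝ)).comp_tendsto h0
  -- The constant `exp (-b)` absorbs the shift from `n` to `n + 1`.
  have h2 := h1.bound (Real.exp_pos (-b))
  filter_upwards [h2] with n hn
  rw [show ((b : EReal) * (n : EReal)) = ((b * n : ℝ) : EReal) by
    rw [EReal.coe_mul]; rfl, EReal.exp_coe, ← ENNReal.ofReal_natCast]
  refine ENNReal.ofReal_le_ofReal ?_
  simp only [Function.comp_apply, Real.norm_eq_abs, Real.abs_exp] at hn
  rw [← Real.exp_add, show -b + b * (n + 1) = b * n by ring] at hn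
  push_cast
  exact (le_abs_self _).trans hn

/-- A map has zero entropy if orbits of length `n` are determined, up to `ε`, by polynomially many
codes. -/
lemma coverEntropy_eq_zero_of_coding {X : Type*} [PseudoMetricSpace X] [Nonempty X] {T : X → X}
    (H : ∀ ε > 0, ∃ A d : ℕ, ∀ n : ℕ, ∃ (ι : Type) (code : X → ι) (s : Finset ι),
      (∀ x, code x ∈ s) ∧ s.card ≤ A * (n + 1) ^ d ∧
      ∀ x y, code x = code y → ∀ i < n, dist (T^[i] x) (T^[i] y) < ε) :
    Dynamics.coverEntropy T Set.univ = 0 := by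
  classical
  refine le_antisymm (iSup₂_le fun U hU => ?_)
    (Dynamics.coverEntropy_nonneg T Set.univ_nonempty)
  obtain ⟨ε, hε, hU⟩ := Metric.mem_uniformity_dist.1 hU
  obtain ⟨A, d, h⟩ := H ε hε
  refine (ExpGrowth.expGrowthSup_monotone fun n => ?_).trans (expGrowthSup_polynomial_le A d)
  obtain ⟨ι, code, s, h1, h2, h3⟩ := h n
  let rep : ι → X := fun c => if h : ∃ x, code x = c then h.choose else Classical.arbitrary X
  have hrep : ∀ x, code (rep (code x)) = code x := fun x => by
    have h : ∃ y, code y = code x := ⟨x, rfl⟩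
    simp only [rep, dif_pos h]
    exact h.choose_spec
  have hcov : Dynamics.IsDynCoverOf T Set.univ U n (s.image rep : Finset X) := by
    intro x _
    refine ⟨rep (code x), by simpa using ⟨_, h1 x, rfl⟩, ?_⟩
    exact Dynamics.mem_dynEntourage.2 fun i hi => hU (h3 _ _ (hrep x).symm i hi)
  have := hcov.coverMincard_le_card.trans
    (Nat.cast_le.2 (Finset.card_image_le.trans h2) : _ ≤ ((A * (n + 1) ^ d : ℕ) : ℕ∞))
  have h4 := ENat.toENNReal_le.2 this
  rwa [ENat.toENNReal_coe] at h4

section ActEntropy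

variable {k m q : ℕ} {hq : q = 2 * m ∨ q = 2 * m + 1} {α : ℕ → ((Fin k → ℤ) →+ (Fin m → ℚ))}

lemma iterate_diskPerm (γ : Fin k → ℤ) (n : ℕ) (x : Disk q) :
    (((diskPerm hq α γ)^[n] x : Disk q) : Euc q) = limAct hq α (n • γ) x := by
  induction n with
  | zero => simp [limAct_zero]
  | succ n ih =>
    rw [Function.iterate_succ_apply', succ_nsmul', limAct_add, ← ih]
    rfl

/-- Take a stage with disks of diameter less than `ε`. A point in one of them is coded by its
center, since the disks are permuted; any other point is coded by a cubical grid, since it moves by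
a finite stage with Lipschitz constant linear in time. A mesh of order `1 / n` suffices. -/
lemma coverEntropy_diskPerm (γ : Fin k → ℤ) :
    Dynamics.coverEntropy (diskPerm hq α γ) Set.univ = 0 := by
  classical
  have : Nonempty (Disk q) := ⟨⟨0, by simp⟩⟩
  refine coverEntropy_eq_zero_of_coding fun ε hε => ?_
  obtain ⟨ℓ, hℓ⟩ : ∃ ℓ, (stages hq α ℓ).R < ε / 2 :=
    ((tendsto_stages_R hq α).eventually_lt_const (by linarith)).exists
  obtain ⟨C, hC, hLip⟩ := exists_partialAct_lipschitz hq α ℓ γ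
  set S := stages hq α ℓ
  -- With mesh `1 / (B (n + 1))`, points with the same grid code stay within `C (n + 1) q / (B (n +
  -- 1)) = C q / B < ε`.
  obtain ⟨B, hB⟩ := exists_nat_gt (C * q / ε)
  have hB0 : 0 < (B : ℝ) := lt_of_le_of_lt (by positivity) hB
  refine ⟨S.centers.card + (2 * B + 1) ^ q, q, fun n => ?_⟩
  set N : ℕ := B * (n + 1) with hN
  have hN0 : 0 < (N : ℝ) := by rw [hN]; push_cast; positivity
  let code : Disk q → Euc q ⊕ (Fin q → ℤ) := fun x =>
    if h : ∃ γ', ‖(x : Euc q) - S.c γ'‖ < S.R then .inl (S.c h.choose)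
    else .inr fun i => ⌊N * (x : Euc q) i⌋
  refine ⟨_, code, S.centers.disjSum
    (Fintype.piFinset fun _ => Finset.Icc (-(N : ℤ)) N), fun x => ?_, ?_, fun x y hxy i hi => ?_⟩
  · by_cases h : ∃ γ', ‖(x : Euc q) - S.c γ'‖ < S.R
    · simp only [code, dif_pos h, Finset.inl_mem_disjSum, S.mem_centers]
      exact ⟨_, rfl⟩
    · simp only [code, dif_neg h, Finset.inr_mem_disjSum, Fintype.mem_piFinset, Finset.mem_Icc]
      intro i
      have h1 := abs_le.1 ((abs_apply_le_norm (x : Euc q) i).trans (mem_closedBall_zero_iff.1 x.2))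
      refine ⟨Int.le_floor.2 ?_, Int.cast_le (R := ℝ).1 ((Int.floor_le _).trans ?_)⟩ <;>
      · push_cast
        nlinarith
  · rw [Finset.card_disjSum, Fintype.card_piFinset_const, Int.card_Icc]
    have e : ((N : ℤ) + 1 - -(N : ℤ)).toNat = 2 * N + 1 := by omega
    rw [e, add_mul, ← mul_pow]
    refine add_le_add (Nat.le_mul_of_pos_right _ (by positivity)) (Nat.pow_le_pow_left ?_ _)
    rw [hN]; nlinarith
  · rw [Subtype.dist_eq, iterate_diskPerm, iterate_diskPerm, dist_eq_norm]
    by_cases hx : ∃ γ', ‖(x : Euc q) - S.c γ'‖ < S.R <;>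
    by_cases hy : ∃ γ', ‖(y : Euc q) - S.c γ'‖ < S.R <;>
    simp only [code, hx, hy, ↓reduceDIte, reduceCtorEq, Sum.inl.injEq, Sum.inr.injEq] at hxy
    · have h1 := norm_limAct_sub_lt hq α hx.choose_spec (i • γ)
      have h2 := hy.choose_spec
      rw [← hxy] at h2
      have h3 := norm_limAct_sub_lt hq α h2 (i • γ)
      rw [norm_sub_rev] at h3
      have h4 := norm_sub_le_norm_sub_add_norm_sub (limAct hq α (i • γ) x)
        (S.c (i • γ + hx.choose)) (limAct hq α (i • γ) y)
      linarith
    · push Not at hx hy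
      rw [limAct_of_forall hq α hx, limAct_of_forall hq α hy]
      refine (hLip i x y).trans_lt ?_
      have h1 : ‖(x : Euc q) - y‖ ≤ q * (1 / N) := by
        refine (norm_le_sum_abs _).trans ((Finset.sum_le_sum
          (g := fun _ => (1 / N : ℝ)) fun j _ => ?_).trans_eq (by simp))
        have := Int.abs_sub_lt_one_of_floor_eq_floor (congrFun hxy j)
        rw [← mul_sub, abs_mul, abs_of_pos hN0] at this
        rw [le_div_iff₀ hN0, mul_comm]
        exact this.le
      have hi' : (i : ℝ) + 1 ≤ n + 1 := by
        have : (i : ℝ) ≤ n := by exact_mod_cast hi.le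
        linarith
      calc C * (i + 1) * ‖(x : Euc q) - y‖ ≤ C * (n + 1) * (q * (1 / N)) := by gcongr
        _ = C * q / B := by
          rw [hN]; push_cast; field_simp
        _ < ε := by
          rw [div_lt_iff₀ hε] at hB
          rw [div_lt_iff₀ hB0]; linarith

end ActEntropy

/-! ### Distality -/

section Distal

variable {k m q : ℕ} (hq : q = 2 * m ∨ q = 2 * m + 1) (α : ℕ → ((Fin k → ℤ) →+ (Fin m → ℚ)))

/-- The orbit of `x` keeps a definite distance from the boundaries of the disks, and the orbit of
`y` stays outside them. -/
lemma exists_le_norm_limAct_sub_of_mem_of_forall {ℓ : ℕ} {x y : Euc q} {γ₁ : Fin k → ℤ}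
    (hx : ‖x - (stages hq α ℓ).c γ₁‖ < (stages hq α ℓ).R)
    (hy : ∀ γ', (stages hq α ℓ).R ≤ ‖y - (stages hq α ℓ).c γ'‖) :
    ∃ ε > 0, ∀ γ, ε ≤ ‖limAct hq α γ x - limAct hq α γ y‖ := by
  have hR := (stages hq α ℓ).R_pos
  refine ⟨(stages hq α ℓ).R - max ‖x - (stages hq α ℓ).c γ₁‖ ((stages hq α ℓ).R / 2),
    sub_pos.2 (max_lt hx (half_lt_self hR)), fun γ => ?_⟩
  have h1 := norm_limAct_sub_le hq α hx.le γ
  have h2 := forall_le_norm_limAct_sub hq α hy γ (γ + γ₁)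
  have h3 := norm_sub_le_norm_sub_add_norm_sub (limAct hq α γ y) (limAct hq α γ x)
    ((stages hq α ℓ).c (γ + γ₁))
  rw [norm_sub_rev (limAct hq α γ y) (limAct hq α γ x)] at h3
  linarith

/-- Neither point is affected by later stages, so distances to the center are preserved. If they
differ, their difference is a lower bound; if they agree, both points undergo the same rotation on
one sphere. -/
lemma norm_limAct_sub_limAct_ge_of_mem {ℓ : ℕ} {x y : Euc q} {γ' : Fin k → ℤ} (hxy : x ≠ y)
    (hx : ‖x - (stages hq α ℓ).c γ'‖ ≤ (stages hq α ℓ).R)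
    (hy : ‖y - (stages hq α ℓ).c γ'‖ ≤ (stages hq α ℓ).R)
    (hx' : ∀ γ', (stages hq α (ℓ + 1)).R ≤ ‖x - (stages hq α (ℓ + 1)).c γ'‖)
    (hy' : ∀ γ', (stages hq α (ℓ + 1)).R ≤ ‖y - (stages hq α (ℓ + 1)).c γ'‖) :
    ∃ ε > 0, ∀ γ, ε ≤ ‖limAct hq α γ x - limAct hq α γ y‖ := by
  by_cases hn : ‖x - (stages hq α ℓ).c γ'‖ = ‖y - (stages hq α ℓ).c γ'‖
  · refine ⟨‖x - y‖, norm_pos_iff.2 (sub_ne_zero.2 hxy), fun γ => le_of_eq ?_⟩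
    rw [limAct_of_forall hq α hx', limAct_of_forall hq α hy', partialAct_succ_of_mem hq α hx,
      partialAct_succ_of_mem hq α hy, add_sub_add_left_eq_sub, ← torusRot_sub, norm_torusRot,
      twist, twist, cutoff_congr hn, ← torusRot_sub, norm_torusRot, sub_sub_sub_cancel_right]
  · refine ⟨|‖x - (stages hq α ℓ).c γ'‖ - ‖y - (stages hq α ℓ).c γ'‖|,
      abs_pos.2 (sub_ne_zero.2 hn), fun γ => ?_⟩
    rw [← norm_limAct_sub_eq hq α hx hx' γ, ← norm_limAct_sub_eq hq α hy hy' γ]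
    refine (abs_norm_sub_norm_le _ _).trans_eq ?_
    rw [sub_sub_sub_cancel_right]

/-- Orbits of distinct points stay a bounded distance apart. -/
lemma exists_le_norm_limAct_sub {x y : Euc q} (hxy : x ≠ y) :
    ∃ ε > 0, ∀ γ, ε ≤ ‖limAct hq α γ x - limAct hq α γ y‖ := by
  classical
  set P : ℕ → Prop := fun ℓ => ∃ γ', ‖x - (stages hq α ℓ).c γ'‖ < (stages hq α ℓ).R ∧
    ‖y - (stages hq α ℓ).c γ'‖ < (stages hq α ℓ).R
  have hex : ∃ ℓ, ¬ P ℓ := by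
    have hpos : 0 < ‖x - y‖ / 2 := half_pos (norm_pos_iff.2 (sub_ne_zero.2 hxy))
    obtain ⟨ℓ, hℓ⟩ := ((tendsto_stages_R hq α).eventually_lt_const hpos).exists
    refine ⟨ℓ, fun ⟨γ', h1, h2⟩ => ?_⟩
    rw [norm_sub_rev] at h2
    linarith [norm_sub_le_norm_sub_add_norm_sub x ((stages hq α ℓ).c γ') y]
  -- The first stage at which no open disk contains both points.
  obtain ⟨ℓ, hℓ, hmin⟩ : ∃ ℓ, ¬ P ℓ ∧ ∀ i < ℓ, P i :=
    ⟨Nat.find hex, Nat.find_spec hex, fun i hi => not_not.1 (Nat.find_min hex hi)⟩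
  have hR := (stages hq α ℓ).R_pos
  by_cases hx : ∃ γ₁, ‖x - (stages hq α ℓ).c γ₁‖ < (stages hq α ℓ).R
  · obtain ⟨γ₁, hx⟩ := hx
    by_cases hy : ∃ γ₂, ‖y - (stages hq α ℓ).c γ₂‖ < (stages hq α ℓ).R
    · obtain ⟨γ₂, hy⟩ := hy
      have hγ : γ₁ - γ₂ ∉ (stages hq α ℓ).Φ.range := fun h =>
        hℓ ⟨γ₁, hx, by rwa [(stages hq α ℓ).c_eq _ _ h]⟩
      refine ⟨(stages hq α ℓ).R - max ‖x - (stages hq α ℓ).c γ₁‖ ((stages hq α ℓ).R / 2),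
        sub_pos.2 (max_lt hx (half_lt_self hR)), fun γ => ?_⟩
      have h1 := norm_limAct_sub_le hq α hx.le γ
      have h2 := norm_limAct_sub_lt hq α hy γ
      have h3 := (stages hq α ℓ).c_sep (γ + γ₁) (γ + γ₂) (by simpa using hγ)
      rw [← dist_eq_norm, dist_comm] at h1
      rw [← dist_eq_norm] at h2
      rw [← dist_eq_norm (limAct hq α γ x)]
      linarith [dist_triangle4 ((stages hq α ℓ).c (γ + γ₁)) (limAct hq α γ x) (limAct hq α γ y)
        ((stages hq α ℓ).c (γ + γ₂))]
    · push Not at hy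
      exact exists_le_norm_limAct_sub_of_mem_of_forall hq α hx hy
  · push Not at hx
    by_cases hy : ∃ γ₂, ‖y - (stages hq α ℓ).c γ₂‖ < (stages hq α ℓ).R
    · obtain ⟨γ₂, hy⟩ := hy
      simp_rw [norm_sub_rev (limAct hq α _ x)]
      exact exists_le_norm_limAct_sub_of_mem_of_forall hq α hy hx
    · push Not at hy
      rcases ℓ with _ | ℓ
      · refine ⟨‖x - y‖, norm_pos_iff.2 (sub_ne_zero.2 hxy), fun γ => le_of_eq ?_⟩
        rw [limAct_of_forall hq α hx, limAct_of_forall hq α hy, partialAct_zero, partialAct_zero]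
      · obtain ⟨γ', h1, h2⟩ := hmin ℓ (Nat.lt_succ_self ℓ)
        exact norm_limAct_sub_limAct_ge_of_mem hq α hxy h1.le h2.le hx hy

lemma isDistal_diskPerm : IsDistal fun γ => (diskPerm hq α γ : Disk q → Disk q) := fun _ _ hxy =>
  exists_le_norm_limAct_sub hq α fun h => hxy (Subtype.ext h)

end Distal

/-! ### The invariant Cantor set -/

lemma isInvariantSet_of_mapsTo {G X : Type*} [AddGroup G] {T : G → X → X} {S : Set X}
    (hT : ∀ g x, T g (T (-g) x) = x) (h : ∀ g, ∀ x ∈ S, T g x ∈ S) : IsInvariantSet T S := by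
  intro g
  refine Set.Subset.antisymm ?_ fun x hx => ⟨T (-g) x, h _ _ hx, hT g x⟩
  rintro _ ⟨x, hx, rfl⟩
  exact h g x hx

section Cantor

variable {k m q : ℕ} (hq : q = 2 * m ∨ q = 2 * m + 1) (α : ℕ → ((Fin k → ℤ) →+ (Fin m → ℚ)))

/-- The centers of the disks of stage `ℓ`. -/
def diskCenter (ℓ : ℕ) (γ : Fin k → ℤ) : Disk q := ⟨(stages hq α ℓ).c γ, by
  have h1 := (stages hq α ℓ).norm_add_le γ
  have h2 := (stages hq α ℓ).R_pos
  exact mem_closedBall_zero_iff.2 (by linarith)⟩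

lemma mem_ball_diskCenter {ℓ : ℕ} {γ : Fin k → ℤ} {x : Disk q} {ρ : ℝ} :
    x ∈ Metric.ball (diskCenter hq α ℓ γ) ρ ↔ ‖(x : Euc q) - (stages hq α ℓ).c γ‖ < ρ := by
  rw [Metric.mem_ball, Subtype.dist_eq, dist_eq_norm]; rfl

lemma diskPerm_neg_apply (γ : Fin k → ℤ) (x : Disk q) :
    diskPerm hq α γ (diskPerm hq α (-γ) x) = x := Subtype.ext (limAct_limAct_neg hq α γ x)

lemma diskPerm_mem_ball {ℓ : ℕ} {γ' : Fin k → ℤ} {x : Disk q}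
    (h : x ∈ Metric.ball (diskCenter hq α ℓ γ') (stages hq α ℓ).R) (γ : Fin k → ℤ) :
    diskPerm hq α γ x ∈ Metric.ball (diskCenter hq α ℓ (γ + γ')) (stages hq α ℓ).R := by
  rw [mem_ball_diskCenter] at h ⊢
  exact norm_limAct_sub_lt hq α h γ

lemma diskPerm_image_ball (ℓ : ℕ) (γ γ' : Fin k → ℤ) :
    diskPerm hq α γ '' Metric.ball (diskCenter hq α ℓ γ') (stages hq α ℓ).R =
      Metric.ball (diskCenter hq α ℓ (γ + γ')) (stages hq α ℓ).R := by
  refine Set.Subset.antisymm ?_ fun x hx => ⟨diskPerm hq α (-γ) x, ?_, diskPerm_neg_apply hq α γ x⟩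
  · rintro _ ⟨x, hx, rfl⟩
    exact diskPerm_mem_ball hq α hx γ
  · simpa using diskPerm_mem_ball hq α hx (-γ)

/-- The union of the open disks of radius `ρ` about the centers of stage `ℓ`. -/
def diskUnion (ℓ : ℕ) (ρ : ℝ) : Set (Disk q) := ⋃ γ, Metric.ball (diskCenter hq α ℓ γ) ρ

/-- The intersection of the unions of the disks of all stages. -/
def limitSet : Set (Disk q) := ⋂ ℓ, diskUnion hq α ℓ (stages hq α ℓ).R

lemma isOpen_diskUnion (ℓ : ℕ) (ρ : ℝ) : IsOpen (diskUnion hq α ℓ ρ) :=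
  isOpen_iUnion fun _ => Metric.isOpen_ball

lemma mem_diskUnion {ℓ : ℕ} {ρ : ℝ} {x : Disk q} :
    x ∈ diskUnion hq α ℓ ρ ↔ ∃ γ, x ∈ Metric.ball (diskCenter hq α ℓ γ) ρ := Set.mem_iUnion

lemma exists_mem_ball_of_mem_limitSet {x : Disk q} (hx : x ∈ limitSet hq α) (ℓ : ℕ) :
    ∃ γ, x ∈ Metric.ball (diskCenter hq α ℓ γ) (stages hq α ℓ).R :=
  (mem_diskUnion hq α).1 (Set.mem_iInter.1 hx ℓ)

lemma closure_diskUnion_succ_subset (ℓ : ℕ) :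
    closure (diskUnion hq α (ℓ + 1) (stages hq α (ℓ + 1)).R) ⊆
      diskUnion hq α ℓ (stages hq α ℓ).R := by
  intro x hx
  have hR := (stages hq α ℓ).R_pos
  -- There is room for `R / 8`, as `y` lies within `R / 2` of a center of stage `ℓ`.
  obtain ⟨y, hy, hxy⟩ := Metric.mem_closure_iff.1 hx ((stages hq α ℓ).R / 8) (by linarith)
  obtain ⟨γ, hy⟩ := (mem_diskUnion hq α).1 hy
  rw [mem_ball_diskCenter] at hy
  have h1 := norm_sub_le_of_succ hq α hy.le
  refine (mem_diskUnion hq α).2 ⟨γ, (mem_ball_diskCenter hq α).2 ?_⟩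
  rw [Subtype.dist_eq, dist_eq_norm] at hxy
  linarith [norm_sub_le_norm_sub_add_norm_sub (x : Euc q) y ((stages hq α ℓ).c γ)]

lemma limitSet_eq_iInter_closure :
    limitSet hq α = ⋂ ℓ, closure (diskUnion hq α ℓ (stages hq α ℓ).R) := by
  refine Set.Subset.antisymm (Set.iInter_mono fun ℓ => subset_closure) fun x hx => ?_
  exact Set.mem_iInter.2 fun ℓ =>
    closure_diskUnion_succ_subset hq α ℓ (Set.mem_iInter.1 hx (ℓ + 1))

lemma isCompact_limitSet : IsCompact (limitSet hq α) := by
  rw [limitSet_eq_iInter_closure]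
  exact (isClosed_iInter fun _ => isClosed_closure).isCompact

lemma limitSet_nonempty : (limitSet hq α).Nonempty := by
  rw [limitSet_eq_iInter_closure]
  refine IsCompact.nonempty_iInter_of_sequence_nonempty_isCompact_isClosed _
    (fun ℓ => (closure_diskUnion_succ_subset hq α ℓ).trans subset_closure) (fun ℓ => ?_)
    isClosed_closure.isCompact fun _ => isClosed_closure
  exact ⟨diskCenter hq α ℓ 0, subset_closure ((mem_diskUnion hq α).2
    ⟨0, Metric.mem_ball_self (stages hq α ℓ).R_pos⟩)⟩

lemma diskPerm_mem_limitSet (γ : Fin k → ℤ) {x : Disk q} (hx : x ∈ limitSet hq α) :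
    diskPerm hq α γ x ∈ limitSet hq α := by
  refine Set.mem_iInter.2 fun ℓ => ?_
  obtain ⟨γ', h⟩ := exists_mem_ball_of_mem_limitSet hq α hx ℓ
  exact (mem_diskUnion hq α).2 ⟨_, diskPerm_mem_ball hq α h γ⟩

lemma isInvariantSet_limitSet :
    IsInvariantSet (fun γ => (diskPerm hq α γ : Disk q → Disk q)) (limitSet hq α) :=
  isInvariantSet_of_mapsTo (diskPerm_neg_apply hq α) fun γ _ => diskPerm_mem_limitSet hq α γ

lemma exists_diskPerm_mem_ball {x : Disk q} (hx : x ∈ limitSet hq α) (ℓ : ℕ) (γ : Fin k → ℤ) :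
    ∃ γ₀, diskPerm hq α γ₀ x ∈ Metric.ball (diskCenter hq α ℓ γ) (stages hq α ℓ).R := by
  obtain ⟨γ', h⟩ := exists_mem_ball_of_mem_limitSet hq α hx ℓ
  exact ⟨γ - γ', by simpa using diskPerm_mem_ball hq α h (γ - γ')⟩

lemma dist_lt_of_mem_ball {X : Type*} [PseudoMetricSpace X] {x y z : X} {ρ : ℝ}
    (hx : x ∈ Metric.ball z ρ) (hy : y ∈ Metric.ball z ρ) : dist x y < 2 * ρ := by
  rw [Metric.mem_ball] at hx hy
  linarith [dist_triangle_right x y z]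

lemma exists_two_mul_stages_R_lt {ε : ℝ} (hε : 0 < ε) : ∃ ℓ, 2 * (stages hq α ℓ).R < ε := by
  obtain ⟨ℓ, hℓ⟩ := ((tendsto_stages_R hq α).eventually_lt_const (half_pos hε)).exists
  exact ⟨ℓ, by linarith⟩

/-- The disks of each stage are permuted transitively and their radii tend to zero. -/
lemma isMinimalOn_limitSet :
    IsMinimalOn (fun γ => (diskPerm hq α γ : Disk q → Disk q)) (limitSet hq α) := by
  intro x hx y hy
  refine Metric.mem_closure_iff.2 fun ε hε => ?_
  obtain ⟨ℓ, hℓ⟩ := exists_two_mul_stages_R_lt hq α hε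
  obtain ⟨γ', h⟩ := exists_mem_ball_of_mem_limitSet hq α hy ℓ
  obtain ⟨γ₀, h'⟩ := exists_diskPerm_mem_ball hq α hx ℓ γ'
  exact ⟨_, ⟨γ₀, rfl⟩, (dist_lt_of_mem_ball h h').trans hℓ⟩

lemma sub_mem_range_of_mem_ball {ℓ : ℕ} {γ γ' : Fin k → ℤ} {x : Disk q}
    (h : x ∈ Metric.ball (diskCenter hq α ℓ γ) (stages hq α ℓ).R)
    (h' : x ∈ Metric.ball (diskCenter hq α ℓ γ') (stages hq α ℓ).R) :
    γ - γ' ∈ (stages hq α ℓ).Φ.range :=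
  Stage.sub_mem_range_of_norm_le ((mem_ball_diskCenter hq α).1 h).le
    ((mem_ball_diskCenter hq α).1 h').le

lemma diskCenter_eq {ℓ : ℕ} {γ γ' : Fin k → ℤ} (h : γ - γ' ∈ (stages hq α ℓ).Φ.range) :
    diskCenter hq α ℓ γ = diskCenter hq α ℓ γ' := Subtype.ext ((stages hq α ℓ).c_eq _ _ h)

/-- At each stage the limit set is covered by disjoint open disks, so a connected subset lies in a
single disk, of arbitrarily small diameter. -/
lemma isTotallyDisconnected_limitSet : IsTotallyDisconnected (limitSet hq α) := by
  intro t ht hconn x hx y hy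
  by_contra hxy
  obtain ⟨ℓ, hℓ⟩ := exists_two_mul_stages_R_lt hq α (dist_pos.2 hxy)
  obtain ⟨γ, h⟩ := exists_mem_ball_of_mem_limitSet hq α (ht hx) ℓ
  set W : Set (Disk q) := ⋃ γ' ∈ {γ' | γ - γ' ∉ (stages hq α ℓ).Φ.range},
    Metric.ball (diskCenter hq α ℓ γ') (stages hq α ℓ).R
  have hsub := hconn.subset_left_of_subset_union Metric.isOpen_ball
    (isOpen_biUnion fun _ _ => Metric.isOpen_ball : IsOpen W)
    (u := Metric.ball (diskCenter hq α ℓ γ) (stages hq α ℓ).R)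
    (Set.disjoint_left.2 fun z hz hz' => by
      obtain ⟨γ', hγ', hz'⟩ := Set.mem_iUnion₂.1 hz'
      exact hγ' (sub_mem_range_of_mem_ball hq α hz hz')) (fun z hz => by
      obtain ⟨γ', hz'⟩ := exists_mem_ball_of_mem_limitSet hq α (ht hz) ℓ
      by_cases hγ' : γ - γ' ∈ (stages hq α ℓ).Φ.range
      · left; rwa [diskCenter_eq hq α hγ']
      · right; exact Set.mem_iUnion₂.2 ⟨γ', hγ', hz'⟩) ⟨x, hx, h⟩
  exact absurd (dist_lt_of_mem_ball h (hsub hy)) (not_lt.2 hℓ.le)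

/-- An element of `Γ_ℓ` outside `Γ_{ℓ+1}` keeps a point in its disk of stage `ℓ` but moves it to
another disk of stage `ℓ + 1`. -/
lemma preperfect_limitSet
    (hα : ∀ ℓ, ∃ γ ∈ (stages hq α ℓ).Φ.range, γ ∉ (stages hq α (ℓ + 1)).Φ.range) :
    Preperfect (limitSet hq α) := by
  intro x hx
  refine accPt_iff_nhds.2 fun N hN => ?_
  obtain ⟨ε, hε, hN⟩ := Metric.mem_nhds_iff.1 hN
  obtain ⟨ℓ, hℓ⟩ := exists_two_mul_stages_R_lt hq α hε
  obtain ⟨γ₀, h0, h1⟩ := hα ℓ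
  obtain ⟨γ, h⟩ := exists_mem_ball_of_mem_limitSet hq α hx ℓ
  obtain ⟨γ', h'⟩ := exists_mem_ball_of_mem_limitSet hq α hx (ℓ + 1)
  have h2 := diskPerm_mem_ball hq α h γ₀
  rw [diskCenter_eq hq α (γ := γ₀ + γ) (γ' := γ) (by simpa using h0)] at h2
  refine ⟨diskPerm hq α γ₀ x, ⟨hN ?_, diskPerm_mem_limitSet hq α γ₀ hx⟩, fun he => h1 ?_⟩
  · exact (dist_lt_of_mem_ball h2 h).trans hℓ
  · have h3 := diskPerm_mem_ball hq α h' γ₀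
    rw [he] at h3
    simpa using sub_mem_range_of_mem_ball hq α h3 h'

/-- Every disk of stage `ℓ` contains both its core and, by transitivity, a point of the limit set.
-/
lemma tendsto_hausdorffEDist_diskUnion :
    Tendsto (fun ℓ => Metric.hausdorffEDist (diskUnion hq α ℓ ((stages hq α ℓ).R / 8))
      (limitSet hq α)) atTop (𝓝 0) := by
  have h0 : Tendsto (fun ℓ => ENNReal.ofReal (2 * (stages hq α ℓ).R)) atTop (𝓝 0) := by
    have := ENNReal.tendsto_ofReal ((tendsto_stages_R hq α).const_mul 2)
    simpa using this
  refine tendsto_of_tendsto_of_tendsto_of_le_of_le tendsto_const_nhds h0 (fun _ => zero_le)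
    fun ℓ => ?_
  have hR := (stages hq α ℓ).R_pos
  refine Metric.hausdorffEDist_le_of_mem_edist (fun x hx => ?_) fun x hx => ?_
  · obtain ⟨γ, h⟩ := (mem_diskUnion hq α).1 hx
    obtain ⟨z, hz⟩ := limitSet_nonempty hq α
    obtain ⟨γ₀, h'⟩ := exists_diskPerm_mem_ball hq α hz ℓ γ
    refine ⟨_, diskPerm_mem_limitSet hq α γ₀ hz, ?_⟩
    rw [edist_dist]
    exact ENNReal.ofReal_le_ofReal
      (dist_lt_of_mem_ball (Metric.ball_subset_ball (by linarith) h) h').le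
  · obtain ⟨γ, h⟩ := exists_mem_ball_of_mem_limitSet hq α hx ℓ
    refine ⟨diskCenter hq α ℓ γ, (mem_diskUnion hq α).2
      ⟨γ, Metric.mem_ball_self (by linarith)⟩, ?_⟩
    rw [edist_dist]
    exact ENNReal.ofReal_le_ofReal (dist_lt_of_mem_ball h (Metric.mem_ball_self hR)).le

end Cantor

/-! ### The bounds on the representations -/

section Rate

variable {k m q : ℕ} (hq : q = 2 * m ∨ q = 2 * m + 1)

/-- The extension by zero of a finite sequence of representations. -/
def extendByZero {ℓ : ℕ} (a : Fin ℓ → ((Fin k → ℤ) →+ (Fin m → ℚ))) :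
    ℕ → ((Fin k → ℤ) →+ (Fin m → ℚ)) := fun i => if h : i < ℓ then a ⟨i, h⟩ else 0

/-- The bound on the representation `α ℓ` in terms of the preceding ones. -/
def rate (r : ℕ) {δ : ℝ} (hδ : 0 < δ) (ℓ : ℕ) (a : Fin ℓ → ((Fin k → ℤ) →+ (Fin m → ℚ))) : ℝ :=
  ((stages hq (extendByZero a) ℓ).exists_rate hq r
    (show 0 < δ / 4 * (1 / 2) ^ ℓ by positivity)).choose

variable {r : ℕ} {δ : ℝ} (hδ : 0 < δ)

lemma rate_pos (ℓ : ℕ) (a : Fin ℓ → ((Fin k → ℤ) →+ (Fin m → ℚ))) : 0 < rate hq r hδ ℓ a :=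
  ((stages hq (extendByZero a) ℓ).exists_rate hq r
    (show 0 < δ / 4 * (1 / 2) ^ ℓ by positivity)).choose_spec.1

lemma rate_le (ℓ : ℕ) (a : Fin ℓ → ((Fin k → ℤ) →+ (Fin m → ℚ))) : rate hq r hδ ℓ a ≤ 1 / 2 :=
  ((stages hq (extendByZero a) ℓ).exists_rate hq r
    (show 0 < δ / 4 * (1 / 2) ^ ℓ by positivity)).choose_spec.2.1

variable {hq hδ} {α : ℕ → ((Fin k → ℤ) →+ (Fin m → ℚ))}

lemma smallDisp_of_lt_rate
    (h : ∀ ℓ j, ratNorm (α ℓ (gen j)) < rate hq r hδ ℓ (fun i => α i)) (j : Fin k)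
    {γ : Fin k → ℤ} (hγ : γ = gen j ∨ γ = -gen j) : SmallDisp hq α r δ γ := by
  intro ℓ
  have e : stages hq (extendByZero fun i : Fin ℓ => α i) ℓ = stages hq α ℓ :=
    stages_congr hq fun i hi => by simp [extendByZero, hi]
  have := ((stages hq (extendByZero fun i : Fin ℓ => α i) ℓ).exists_rate hq r
    (show 0 < δ / 4 * (1 / 2) ^ ℓ by positivity)).choose_spec.2.2 (α ℓ) (h ℓ) j γ hγ
  rwa [e] at this

/-- A non-zero `α ℓ` is non-zero on some generator, and a non-zero vector of norm less than `1 / 2`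
is not integral. -/
lemma exists_mem_range_stages_Φ_of_lt_rate (hα : ∀ ℓ, α ℓ ≠ 0)
    (h : ∀ ℓ j, ratNorm (α ℓ (gen j)) < rate hq r hδ ℓ (fun i => α i)) (ℓ : ℕ) :
    ∃ γ ∈ (stages hq α ℓ).Φ.range, γ ∉ (stages hq α (ℓ + 1)).Φ.range := by
  obtain ⟨j, hj⟩ : ∃ j, α ℓ (gen j) ≠ 0 := by
    by_contra! h0
    exact hα ℓ (AddMonoidHom.ext fun γ => by
      rw [map_eq_sum_gen]; simp [h0])
  refine ⟨_, ⟨gen j, rfl⟩, fun hmem => hj ?_⟩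
  obtain ⟨n, hn⟩ := mem_intLattice.1
    (((stages hq α ℓ).Φ_mem_range_nextΦ_iff (α ℓ) (gen j)).1 hmem)
  ext i
  have h1 := (abs_apply_le_ratNorm (α ℓ (gen j)) i).trans_lt
    ((h ℓ j).trans_le (rate_le hq hδ ℓ _))
  rw [hn i] at h1 ⊢
  have h2 : |n i| < 1 := by
    have : |(n i : ℝ)| < 1 := by
      have e : (((n i : ℚ) : ℝ)) = (n i : ℝ) := by norm_cast
      rw [e] at h1; linarith
    exact_mod_cast this
  simp [Int.abs_lt_one_iff.1 h2]

end Rate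

/-! ### The action on the cores of the disks -/

section Cores

variable {k m q : ℕ} (hq : q = 2 * m ∨ q = 2 * m + 1) (α : ℕ → ((Fin k → ℤ) →+ (Fin m → ℚ)))

lemma diskPerm_of_mem_core (hq0 : 0 < q) {ℓ : ℕ} {γ' : Fin k → ℤ} {x : Disk q}
    (h : x ∈ Metric.ball (diskCenter hq α ℓ γ') ((stages hq α ℓ).R / 8)) (γ : Fin k → ℤ) :
    (diskPerm hq α γ x : Euc q) = (stages hq α ℓ).c (γ + γ') +
      torusRot hq (realVec ((stages hq α (ℓ + 1)).a γ)) (x - (stages hq α ℓ).c γ') :=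
  limAct_of_norm_sub_lt hq α hq0 ((mem_ball_diskCenter hq α).1 h) γ

lemma diskPerm_mem_core (hq0 : 0 < q) {ℓ : ℕ} {γ' : Fin k → ℤ} {x : Disk q}
    (h : x ∈ Metric.ball (diskCenter hq α ℓ γ') ((stages hq α ℓ).R / 8)) (γ : Fin k → ℤ) :
    diskPerm hq α γ x ∈ Metric.ball (diskCenter hq α ℓ (γ + γ')) ((stages hq α ℓ).R / 8) := by
  rw [mem_ball_diskCenter, diskPerm_of_mem_core hq α hq0 h, add_sub_cancel_left, norm_torusRot]
  exact (mem_ball_diskCenter hq α).1 h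

lemma isInvariantSet_core (hq0 : 0 < q) (ℓ : ℕ) :
    IsInvariantSet (fun γ => (diskPerm hq α γ : Disk q → Disk q))
      (diskUnion hq α ℓ ((stages hq α ℓ).R / 8)) :=
  isInvariantSet_of_mapsTo (diskPerm_neg_apply hq α) fun γ x hx => by
    obtain ⟨γ', h⟩ := (mem_diskUnion hq α).1 hx
    exact (mem_diskUnion hq α).2 ⟨_, diskPerm_mem_core hq α hq0 h γ⟩

/-- Fixing a center forces `γ` into `Γ_ℓ`; fixing in addition a point of the core in direction
`dirVec` forces its rotation parameter to be integral. -/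
lemma diskPerm_fixes_core_iff (hq0 : 0 < q) (ℓ : ℕ) (γ : Fin k → ℤ) :
    (∀ x ∈ diskUnion hq α ℓ ((stages hq α ℓ).R / 8), diskPerm hq α γ x = x) ↔
      γ ∈ (stages hq α (ℓ + 1)).Φ.range := by
  have hR := (stages hq α ℓ).R_pos
  constructor
  · intro h
    have hfix : ∀ x : Euc q, ‖x - (stages hq α ℓ).c 0‖ < (stages hq α ℓ).R / 8 →
        (stages hq α ℓ).c γ + torusRot hq (realVec ((stages hq α (ℓ + 1)).a γ))
          (x - (stages hq α ℓ).c 0) = x := by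
      intro x hx
      have hx1 : ‖x‖ ≤ 1 := by
        linarith [norm_le_norm_add_norm_sub' x ((stages hq α ℓ).c 0),
          (stages hq α ℓ).norm_add_le 0]
      have hmem : (⟨x, mem_closedBall_zero_iff.2 hx1⟩ : Disk q) ∈
          Metric.ball (diskCenter hq α ℓ 0) ((stages hq α ℓ).R / 8) :=
        (mem_ball_diskCenter hq α).2 hx
      have h1 := diskPerm_of_mem_core hq α hq0 hmem γ
      rw [h _ ((mem_diskUnion hq α).2 ⟨0, hmem⟩), add_zero] at h1
      exact h1.symm
    have hc : (stages hq α ℓ).c γ = (stages hq α ℓ).c 0 := by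
      have := hfix ((stages hq α ℓ).c 0) (by simpa using hR)
      simpa using this
    have hγ : γ ∈ (stages hq α ℓ).Φ.range := by
      by_contra hn
      have := (stages hq α ℓ).c_sep γ 0 (by simpa using hn)
      rw [hc, dist_self] at this
      linarith
    -- The test point is at distance at most `R / 16` from the center, inside the core.
    refine (stages hq α ℓ).mem_range_nextΦ_of_torusRot_eq hq (α ℓ) hγ
      (t := (stages hq α ℓ).R / 4) (by positivity) ?_
    have h1 := hfix ((stages hq α ℓ).c 0 + ((stages hq α ℓ).R / 4) • dirVec q) (by
      rw [add_sub_cancel_left, norm_smul, Real.norm_of_nonneg (by positivity)]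
      nlinarith [norm_dirVec_le q])
    rw [add_sub_cancel_left, hc, add_right_inj] at h1
    exact h1
  · intro h x hx
    obtain ⟨γ', hx⟩ := (mem_diskUnion hq α).1 hx
    refine Subtype.ext ?_
    rw [diskPerm_of_mem_core hq α hq0 hx,
      torusRot_realVec_of_mem hq ((stages hq α (ℓ + 1)).a_mem _ h),
      (stages hq α ℓ).c_eq (γ + γ') γ' (by simpa using range_stages_Φ_succ_le hq α ℓ h),
      add_sub_cancel]

lemma finiteRep_a_comp_Φ (ℓ : ℕ) :
    (finiteRep (stages hq α (ℓ + 1)).a).comp (stages hq α ℓ).Φ = finiteRep (α ℓ) := by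
  refine AddMonoidHom.ext fun γ => ?_
  have e : (stages hq α (ℓ + 1)).a ((stages hq α ℓ).Φ γ) =
      (stages hq α ℓ).a ((stages hq α ℓ).Φ γ) + α ℓ γ := by
    rw [← (stages hq α ℓ).lift_apply (α ℓ) γ]; rfl
  have h0 : finiteRep (stages hq α ℓ).a ((stages hq α ℓ).Φ γ) = 0 :=
    finiteRep_apply_eq_zero.2 ((stages hq α ℓ).a_mem _ ⟨γ, rfl⟩)
  have h1 : finiteRep (stages hq α (ℓ + 1)).a ((stages hq α ℓ).Φ γ) =
      finiteRep (stages hq α ℓ).a ((stages hq α ℓ).Φ γ) + finiteRep (α ℓ) γ :=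
    (congrArg (QuotientAddGroup.mk' (intLattice m)) e).trans (map_add _ _ _)
  rw [AddMonoidHom.comp_apply, h1, h0, zero_add]

end Cores

end

/-! ### Assembly of the theorem -/

theorem theorem1p3 (k m q r : ℕ) (hq : q = 2 * m ∨ q = 2 * m + 1) (hr : 1 ≤ r)
    (δ : ℝ) (hδ : 0 < δ) :
    -- the rate: the bound on the `ℓ`-th representation may depend on the preceding ones
    ∃ η : (ℓ : ℕ) → (Fin ℓ → ((Fin k → ℤ) →+ (Fin m → ℚ))) → ℝ,
      (∀ ℓ a, 0 < η ℓ a) ∧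
      ∀ α : ℕ → ((Fin k → ℤ) →+ (Fin m → ℚ)),
        (∀ ℓ, α ℓ ≠ 0) →
        (∀ ℓ j, ratNorm (α ℓ (gen j)) < η ℓ (fun i => α i)) →
        ∃ h : Multiplicative (Fin k → ℤ) →* DiffDisk q r,
          (∀ j : Fin k,
            CrCloseToId r δ (act h (gen j)) ∧
            act h (gen j) ⟨0, by simp⟩ = ⟨0, by simp⟩ ∧
            IsIdNearBoundary (act h (gen j)) ∧
            PreservesVolumeForm (act h (gen j)) ∧
            Dynamics.coverEntropy (act h (gen j)) Set.univ = 0) ∧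
          IsDistal (act h) ∧
          ∃ K : Set (Disk q),
            -- the invariant minimal Cantor set in the open ball
            IsCantorSet K ∧ (∀ x ∈ K, ‖(x : Euc q)‖ < 1) ∧
            IsInvariantSet (act h) K ∧ IsMinimalOn (act h) K ∧
            -- `φ ℓ` is given by a positively oriented basis of the kernel of `α ℓ` mod `ℤ^m`
            ∃ φ : ℕ → (Fin k → ℤ) →+ (Fin k → ℤ),
              (∀ ℓ, (φ ℓ).range = (finiteRep (α ℓ)).ker ∧
                0 < LinearMap.det (φ ℓ).toIntLinearMap) ∧
            -- centers and radii of the disks that make up `V ℓ` and `U ℓ`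
            ∃ (c : ℕ → (Fin k → ℤ) → Disk q) (R s : ℕ → ℝ) (V U : ℕ → Set (Disk q)),
              (∀ ℓ, 0 < s ℓ ∧ s ℓ < R ℓ) ∧
              (∀ ℓ γ, ‖(c ℓ γ : Euc q)‖ + R ℓ ≤ 1) ∧
              (∀ ℓ γ γ', γ - γ' ∈ (towerMap φ ℓ).range → c ℓ γ = c ℓ γ') ∧
              (∀ ℓ γ γ', γ - γ' ∉ (towerMap φ ℓ).range →
                Disjoint (Metric.closedBall (c ℓ γ) (R ℓ)) (Metric.closedBall (c ℓ γ') (R ℓ))) ∧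
              (∀ ℓ, V ℓ = ⋃ γ, Metric.ball (c ℓ γ) (R ℓ)) ∧
              (∀ ℓ, U ℓ = ⋃ γ, Metric.ball (c ℓ γ) (s ℓ)) ∧
              -- the open sets `V ℓ` are nested, with intersection `K`, and their disks are
              -- permuted by the action
              (∀ ℓ, closure (V (ℓ + 1)) ⊆ V ℓ) ∧ (⋂ ℓ, V ℓ) = K ∧
              (∀ ℓ γ γ', act h γ '' Metric.ball (c ℓ γ') (R ℓ) =
                Metric.ball (c ℓ (γ + γ')) (R ℓ)) ∧
              -- the open sets `U ℓ ⊆ V ℓ` are invariant and converge to `K`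
              (∀ ℓ, IsOpen (U ℓ) ∧ IsInvariantSet (act h) (U ℓ)) ∧
              Tendsto (fun ℓ => Metric.hausdorffEDist (U ℓ) K) atTop (𝓝 0) ∧
              -- on `U ℓ` the action is periodic ...
              (∀ ℓ, IsPeriodicOn (act h) (U ℓ)) ∧
              (∀ ℓ γ, (∀ x ∈ U ℓ, act h γ x = x) ↔ γ ∈ (towerMap φ (ℓ + 1)).range) ∧
              -- ... and induced from `α ℓ` mod `ℤ^m`
              (∀ ℓ, ∃ β : (Fin k → ℤ) →+ (Fin m → ℚ),
                (finiteRep β).comp (towerMap φ ℓ) = finiteRep (α ℓ) ∧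
                ∀ γ γ', ∀ x ∈ Metric.ball (c ℓ γ') (s ℓ),
                  (act h γ x : Euc q) = c ℓ (γ + γ') +
                    torusRot hq (fun i => (β γ i : ℝ)) ((x : Euc q) - c ℓ γ')) := by
  refine ⟨rate hq r hδ, rate_pos hq hδ, fun α hα hlt => ?_⟩
  -- A non-zero homomorphism to `ℚ^m` requires `m > 0`.
  have hq0 : 0 < q := by
    rcases Nat.eq_zero_or_pos m with rfl | hm
    · exact (hα 0 (AddMonoidHom.ext fun _ => Subsingleton.elim _ _)).elim
    · omega
  have hs : ∀ j, SmallDisp hq α r δ (gen j) ∧ SmallDisp hq α r δ (-gen j) := fun j =>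
    ⟨smallDisp_of_lt_rate hlt j (.inl rfl), smallDisp_of_lt_rate hlt j (.inr rfl)⟩
  have hR := fun ℓ => (stages hq α ℓ).R_pos
  refine ⟨diskAct hs, fun j => ⟨crCloseToId_act hs hδ j, Subtype.ext ?_, isIdNearBoundary_act hs j,
    preservesVolumeForm_act hs hr j, coverEntropy_diskPerm (gen j)⟩, isDistal_diskPerm hq α,
    limitSet hq α, ⟨limitSet_nonempty hq α, isCompact_limitSet hq α,
      isTotallyDisconnected_limitSet hq α,
      preperfect_limitSet hq α (exists_mem_range_stages_Φ_of_lt_rate hα hlt)⟩, fun x hx => ?_,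
    isInvariantSet_limitSet hq α, isMinimalOn_limitSet hq α, fun ℓ => kerBasis (α ℓ),
    fun ℓ => ⟨range_kerBasis (α ℓ), det_kerBasis_pos (α ℓ)⟩, diskCenter hq α,
    fun ℓ => (stages hq α ℓ).R, fun ℓ => (stages hq α ℓ).R / 8,
    fun ℓ => diskUnion hq α ℓ (stages hq α ℓ).R, fun ℓ => diskUnion hq α ℓ ((stages hq α ℓ).R / 8),
    fun ℓ => ⟨by linarith [hR ℓ], by linarith [hR ℓ]⟩, fun ℓ γ => ?_, fun ℓ γ γ' h => ?_,
    fun ℓ γ γ' h => ?_, fun ℓ => rfl, fun ℓ => rfl, closure_diskUnion_succ_subset hq α, rfl,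
    diskPerm_image_ball hq α, fun ℓ => ⟨isOpen_diskUnion hq α ℓ _, isInvariantSet_core hq α hq0 ℓ⟩,
    tendsto_hausdorffEDist_diskUnion hq α, fun ℓ => ?_, fun ℓ γ => ?_, fun ℓ => ?_⟩
  -- The origin is the center of the only disk of stage 0, whose core is rotated about it.
  · have h0 : ‖(0 : Euc q) - (stages hq α 0).c 0‖ < (stages hq α 0).R / 8 := by
      simp [stages, Stage.first]
    rw [act_diskAct_coe, limAct_of_norm_sub_lt hq α hq0 h0]
    simp [stages, Stage.first]
  · obtain ⟨γ, h⟩ := exists_mem_ball_of_mem_limitSet hq α hx 0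
    rw [mem_ball_diskCenter] at h
    linarith [norm_le_norm_add_norm_sub' (x : Euc q) ((stages hq α 0).c γ),
      (stages hq α 0).norm_add_le γ]
  · exact ((stages hq α ℓ).norm_add_le γ).trans (by norm_num)
  · rw [towerMap_kerBasis hq] at h
    exact diskCenter_eq hq α h
  · rw [towerMap_kerBasis hq] at h
    refine Metric.closedBall_disjoint_closedBall ?_
    have := (stages hq α ℓ).c_sep γ γ' h
    rw [← two_mul]
    exact this
  · exact ⟨(stages hq α (ℓ + 1)).Φ.range, finiteIndex_range (stages hq α (ℓ + 1)).det_pos.ne',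
      fun γ hγ => (diskPerm_fixes_core_iff hq α hq0 ℓ γ).2 hγ⟩
  · rw [towerMap_kerBasis hq]
    exact diskPerm_fixes_core_iff hq α hq0 ℓ γ
  -- Here `β` is the accumulated rotation parameter, the sum of the lifts of `α 0, …, α ℓ`.
  · refine ⟨(stages hq α (ℓ + 1)).a, ?_, fun γ γ' x hx => diskPerm_of_mem_core hq α hq0 hx γ⟩
    rw [towerMap_kerBasis hq]
    exact finiteRep_a_comp_Φ hq α ℓ
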